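/- **Coherence of $M_\equiv$.** Let $\mathcal V$ be an arbitrary (possibly empty, finite or infinite) set of variables. Formulae are built from the atomic formulae $x\equiv y$ ($x,y\in\mathcal V$) and $\top$ by the binary connective $\wedge$. Arrow terms $f\colon A\vdash B$ are built by composition $g\circ f$ and by $f\wedge g$ from the primitive arrow terms (for all formulae $A,B,C$ and variables $x,y,z$) $$\mathbf 1_A\colon A\vdash A,\quad b^{\to}_{A,B,C}\colon A\wedge(B\wedge C)\vdash(A\wedge B)\wedge C,\quad b^{\leftarrow}_{A,B,C}\colon (A\wedge B)\wedge C\vdash A\wedge(B\wedge C),$$ $$\delta^{\to}_A\colon A\wedge\top\vdash A,\quad \delta^{\leftarrow}_A\colon A\vdash A\wedge\top,\quad \sigma^{\to}_A\colon\top\wedge A\vdash A,\quad \sigma^{\leftarrow}_A\colon A\vdash\top\wedge A,$$ $$r_x\colon\top\vdash x\equiv x,\quad t_{x,y,z}\colon x\equiv y\wedge y\equiv z\vdash x\equiv z,\quad s_{x,y}\colon x\equiv y\vdash y\equiv x.$$ The category $M_\equiv$ has the formulae as objects, and its arrows are the equivalence classes of arrow terms with respect to the smallest congruence (for $\circ$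 and $\wedge$, on terms of the same type) that satisfies the equations of monoidal categories (category laws, bifunctoriality of $\wedge$, naturality of $b^\to,\delta^\to,\sigma^\to$, invertibility of $b^\to,\delta^\to,\sigma^\to$ with inverses $b^\leftarrow,\delta^\leftarrow,\sigma^\leftarrow$, the pentagon and triangle equations) and $$t_{x,y,y}\circ(\mathbf 1_{x\equiv y}\wedge r_y)=\delta^{\to}_{x\equiv y},\qquad t_{y,y,x}\circ(r_y\wedge\mathbf 1_{y\equiv x})=\sigma^{\to}_{y\equiv x},$$ $$t_{x,y,u}\circ(\mathbf 1_{x\equiv y}\wedge t_{y,z,u})=t_{x,z,u}\circ(t_{x,y,z}\wedge\mathbf 1_{z\equiv u})\circ b^{\to}_{x\equiv y,\,y\equiv z,\,z\equiv u},$$ $$(ss)\quad s_{y,x}\circ s_{x,y}=\mathbf 1_{x\equiv y},\qquad (rs)\quad s_{x,x}\circ r_x=r_x .$$ Let $\mathit{Br}$ be the category whose objects are the finite ordinals and whose arrows $m\to n$ are the equivalence relations on the disjoint union of $m$ source points and $n$ target points all of whose classes have exactly two elements (Brauerian diagrams); two diagrams are composed by gluing along the middle points and restricting the generated equivalence relation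 to the outer points (closed circles are disregarded). Let $G\colon M_\equiv\to\mathit{Br}$ be the functor that sends a formula to its number of occurrences of variables, sends $\circ$ and $\wedge$ to vertical and horizontal composition of diagrams, sends $\mathbf 1,b^{\to},b^{\leftarrow},\delta^{\to},\delta^{\leftarrow},\sigma^{\to},\sigma^{\leftarrow}$ to diagrams of parallel vertical lines, $r_x$ to the cap joining the two target points, $t_{x,y,z}$ to the diagram that joins the two inner source points by a cup and the two outer source points to the two target points in order, and $s_{x,y}$ to the crossing of two lines. Then $G$ is faithful: if $f,g\colon A\vdash B$ are arrow terms of the same type with $Gf=Gg$, then $f=g$ in $M_\equiv$. -/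

import Mathlib

open CategoryTheory

/-! ## Split equivalences and the category `Br` -/

/-- A split equivalence `m ⊢ n`: an equivalence relation on the disjoint union of the source
points `Fin m` and the target points `Fin n`. -/
abbrev SplitEquiv (m n : ℕ) : Type := Setoid (Fin m ⊕ Fin n)

/-- A split equivalence is Brauerian when each of its classes has exactly two elements. -/
def IsBrauerian {α : Type*} (R : Setoid α) : Prop :=
  ∀ p, ∃! q, q ≠ p ∧ R p q

section Glue

variable {X Y Z : Type*}

/-- The inclusion of the points of the upper diagram into the glued diagram. -/
def glueUpper : X ⊕ Y → X ⊕ (Y ⊕ Z) := Sum.map id Sum.inl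

/-- The inclusion of the points of the lower diagram into the glued diagram. -/
def glueLower : Y ⊕ Z → X ⊕ (Y ⊕ Z) := Sum.inr

/-- The inclusion of the outer points into the glued diagram. -/
def glueOuter : X ⊕ Z → X ⊕ (Y ⊕ Z) := Sum.map id Sum.inr

/-- Two diagrams placed one above the other: the equivalence relation generated by both. -/
def glue (R : Setoid (X ⊕ Y)) (S : Setoid (Y ⊕ Z)) : Setoid (X ⊕ (Y ⊕ Z)) :=
  Relation.EqvGen.setoid fun p q =>
    Relation.Map R glueUpper glueUpper p q ∨ Relation.Map S glueLower glueLower p q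

/-- Vertical composition: glue the two diagrams along the middle points, and keep the induced
equivalence relation on the outer points. -/
def splitComp (R : Setoid (X ⊕ Y)) (S : Setoid (Y ⊕ Z)) : Setoid (X ⊕ Z) :=
  (glue R S).comap glueOuter

end Glue

/-- The disjoint union of two equivalence relations. -/
def sumSetoid {α β : Type*} (R : Setoid α) (S : Setoid β) : Setoid (α ⊕ β) where
  r := Sum.LiftRel R S
  iseqv :=
    { refl := by
        rintro (a | b)
        · exact .inl (R.refl a)
        · exact .inr (S.refl b)
      symm := by
        rintro _ _ (h | h)
        · exact .inl (R.symm h)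
        · exact .inr (S.symm h)
      trans := by
        rintro _ _ _ (h | h) (h' | h')
        · exact .inl (R.trans h h')
        · exact .inr (S.trans h h') }

/-- Regrouping of the points of two diagrams placed side by side. -/
def splitPoints (m n m' n' : ℕ) :
    Fin (m + m') ⊕ Fin (n + n') ≃ (Fin m ⊕ Fin n) ⊕ (Fin m' ⊕ Fin n') :=
  (Equiv.sumCongr finSumFinEquiv.symm finSumFinEquiv.symm).trans
    (Equiv.sumSumSumComm (Fin m) (Fin m') (Fin n) (Fin n'))

/-- Horizontal composition: the second diagram is placed to the right of the first one. -/
def splitTensor {m n m' n' : ℕ} (R : SplitEquiv m n) (S : SplitEquiv m' n') :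
    SplitEquiv (m + m') (n + n') :=
  (sumSetoid R S).comap (splitPoints m n m' n')

/-- The diagram consisting of parallel vertical lines only. -/
def splitLines {m n : ℕ} (h : m = n) : SplitEquiv m n :=
  Setoid.ker (Sum.elim (Fin.cast h) id)

/-- The cap: no source points, two target points, joined to each other. -/
def splitCap : SplitEquiv 0 2 := Setoid.ker (Sum.elim ![] ![0, 0] : Fin 0 ⊕ Fin 2 → ℕ)

/-- Four source points and two target points; the two inner source points are joined by a cup, and
the outer source points are joined to the left and to the right target point respectively. -/
def splitCup : SplitEquiv 4 2 :=
  Setoid.ker (Sum.elim ![0, 1, 1, 2] ![0, 2] : Fin 4 ⊕ Fin 2 → ℕ)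

/-- The crossing of two lines. -/
def splitCross : SplitEquiv 2 2 :=
  Setoid.ker (Sum.elim ![0, 1] ![1, 0] : Fin 2 ⊕ Fin 2 → ℕ)

/-! ### Brauerian split equivalences are closed under the operations -/

theorem dihedral_aux {W : Type*} [Finite W] (a b : Equiv.Perm W)
    (ha : ∀ w, a (a w) = w) (hb : ∀ w, b (b w) = w)
    (hab : ∀ w, ¬ (a w = w ∧ b w = w)) (J : Setoid W)
    (hJa : ∀ w, J w (a w)) (hJb : ∀ w, J w (b w))
    (hJ : ∀ K : Setoid W, (∀ w, K w (a w)) → (∀ w, K w (b w)) → ∀ p q, J p q → K p q)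
    (o : W) (ho : b o = o) :
    ∃! q, q ≠ o ∧ J o q ∧ (a q = q ∨ b q = q) := by
  set c : Equiv.Perm W := a * b with hc
  have hainv : a⁻¹ = a := by ext w; rw [Equiv.Perm.inv_eq_iff_eq, ha]
  have hbinv : b⁻¹ = b := by ext w; rw [Equiv.Perm.inv_eq_iff_eq, hb]
  have hcinv : c⁻¹ = b * a := by rw [hc, mul_inv_rev, hainv, hbinv]
  have haa : a * a = 1 := by ext w; simp [ha]
  have hbb : b * b = 1 := by ext w; simp [hb]
  have hconj : ∀ i : ℤ, b * c ^ i = c ^ (-i) * b := by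
    intro i
    have h1 : b * c * b⁻¹ = c⁻¹ := by
      rw [hcinv, hbinv, hc, mul_assoc, mul_assoc, hbb, mul_one]
    have h2 : b * c ^ i * b⁻¹ = c ^ (-i) := by
      rw [← conj_zpow, h1, inv_zpow, zpow_neg]
    rw [← h2]; group
  have hbi : ∀ i : ℤ, b ((c ^ i) o) = (c ^ (-i)) o := by
    intro i
    have := congrArg (fun e : Equiv.Perm W => e o) (hconj i)
    simpa [ho] using this
  have hai : ∀ i : ℤ, a ((c ^ i) o) = (c ^ (1 - i)) o := by
    intro i
    have h1 : a = c * b := by rw [hc, mul_assoc, hbb, mul_one]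
    have h2 : a ((c ^ i) o) = c (b ((c ^ i) o)) := by
      conv_lhs => rw [h1]
      rfl
    rw [h2, hbi, sub_eq_add_neg, zpow_add, zpow_one]; rfl
  have hJc : ∀ w, J w (c w) := fun w => J.trans (hJb w) (hJa (b w))
  have hJci : ∀ i : ℤ, J o ((c ^ i) o) := by
    intro i
    induction i using Int.induction_on with
    | zero => exact J.refl _
    | succ i ih =>
      refine J.trans ih ?_
      have := hJc ((c ^ (i : ℤ)) o)
      rwa [add_comm, zpow_add, zpow_one]
    | pred i ih =>
      refine J.trans ih (J.symm ?_)
      have := hJc ((c ^ (-(i : ℤ) - 1)) o)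
      have e : c ((c ^ (-(i : ℤ) - 1)) o) = (c ^ (-(i : ℤ))) o := by
        have : c ^ (-(i : ℤ)) = c * c ^ (-(i : ℤ) - 1) := by
          rw [← zpow_one_add]; congr 1; ring
        rw [this]; rfl
      rwa [e] at this
  have horb : ∀ q, J o q → ∃ i : ℤ, q = (c ^ i) o := by
    intro q hq
    have := hJ (Setoid.ker fun w => ∃ i : ℤ, w = (c ^ i) o) ?_ ?_ o q hq
    · have h0 : (∃ i : ℤ, o = (c ^ i) o) = ∃ i : ℤ, q = (c ^ i) o := this
      rw [← h0]; exact ⟨0, by simp⟩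
    · intro w
      refine propext ⟨?_, ?_⟩
      · rintro ⟨i, rfl⟩; exact ⟨_, hai i⟩
      · rintro ⟨i, h⟩; exact ⟨1 - i, by rw [← hai, ← h, ha]⟩
    · intro w
      refine propext ⟨?_, ?_⟩
      · rintro ⟨i, rfl⟩; exact ⟨_, hbi i⟩
      · rintro ⟨i, h⟩; exact ⟨- i, by rw [← hbi, ← h, hb]⟩
  obtain ⟨k, hk0, hk⟩ : ∃ k : ℤ, 0 < k ∧ ∀ i : ℤ, (c ^ i) o = o ↔ k ∣ i := by
    refine ⟨Function.minimalPeriod (c • ·) o, ?_, fun i => ?_⟩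
    · have : o ∈ Function.periodicPts (c • · : W → W) := by
        obtain ⟨n, hn, h⟩ := (isOfFinOrder_of_finite c).exists_pow_eq_one
        refine ⟨n, hn, ?_⟩
        rw [Function.IsPeriodicPt, Function.IsFixedPt, smul_iterate, h]
        exact one_smul _ o
      exact_mod_cast Function.minimalPeriod_pos_of_mem_periodicPts this
    · exact MulAction.zpow_smul_eq_iff_minimalPeriod_dvd (a := c) (b := o) (n := i)
  have hkk : ∀ i j : ℤ, (c ^ i) o = (c ^ j) o ↔ k ∣ i - j := by
    intro i j
    rw [← hk, sub_eq_neg_add, zpow_add, zpow_neg, Equiv.Perm.mul_apply,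
      Equiv.Perm.inv_eq_iff_eq]
  rcases Int.even_or_odd' k with ⟨j, hj | hj⟩
  · refine ⟨(c ^ j) o, ⟨?_, hJci j, .inr ?_⟩, ?_⟩
    · rw [Ne, hk]
      intro h
      have := Int.le_of_dvd (by omega) h
      omega
    · rw [hbi, hkk]; exact ⟨-1, by omega⟩
    · rintro q ⟨hqo, hJq, hq⟩
      obtain ⟨i, rfl⟩ := horb q hJq
      rw [Ne, hk] at hqo
      rw [hai, hbi, hkk, hkk] at hq
      rw [hkk]
      rcases hq with ⟨l, hl⟩ | ⟨l, hl⟩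
      · exfalso
        rw [hj, mul_assoc] at hl
        omega
      · have hi : i = j * (-l) := by
          rw [hj, mul_assoc] at hl; rw [mul_neg]; omega
        rcases Int.even_or_odd' (-l) with ⟨l', h | h⟩
        · exact (hqo ⟨l', by rw [hi, h, hj]; ring⟩).elim
        · exact ⟨l', by rw [hi, h, hj]; ring⟩
  · have hfix : a ((c ^ (j + 1)) o) = (c ^ (j + 1)) o := by
      rw [hai, hkk]; exact ⟨-1, by omega⟩
    refine ⟨(c ^ (j + 1)) o, ⟨?_, hJci _, .inl hfix⟩, ?_⟩
    · intro h
      rw [h] at hfix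
      exact hab o ⟨hfix, ho⟩
    · rintro q ⟨hqo, hJq, hq⟩
      obtain ⟨i, rfl⟩ := horb q hJq
      rw [Ne, hk] at hqo
      rw [hai, hbi, hkk, hkk] at hq
      rw [hkk]
      have hcop : IsCoprime k 2 := ⟨1, -j, by rw [hj]; ring⟩
      rcases hq with ⟨l, hl⟩ | ⟨l, hl⟩
      · refine hcop.dvd_of_dvd_mul_left ⟨-l - 1, ?_⟩
        have e : k * (-l - 1) = -(k * l) - k := by ring
        have e2 : (i - (j + 1)) * 2 = 2 * i - 2 * (j + 1) := by ring
        omega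
      · refine (hqo (hcop.dvd_of_dvd_mul_left ⟨-l, ?_⟩)).elim
        rw [mul_neg, ← hl]; ring

theorem IsBrauerian.exists_partner {α : Type*} {R : Setoid α} (h : IsBrauerian R) :
    ∃ a : α → α, (∀ p, a p ≠ p) ∧ (∀ p, a (a p) = p) ∧ ∀ p q, R p q ↔ q = p ∨ q = a p := by
  choose a h1 h2 using h
  refine ⟨a, fun p => (h1 p).1, fun p => ?_, fun p q => ⟨fun hpq => ?_, ?_⟩⟩
  · exact (h2 (a p) p ⟨(h1 p).1.symm, R.symm (h1 p).2⟩).symm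
  · by_cases hq : q = p
    · exact .inl hq
    · exact .inr (h2 p q ⟨hq, hpq⟩)
  · rintro (rfl | rfl)
    · exact R.refl _
    · exact (h1 p).2

theorem IsBrauerian.splitComp {X Y Z : Type*} [Finite X] [Finite Y] [Finite Z]
    {R : Setoid (X ⊕ Y)} {S : Setoid (Y ⊕ Z)} (hR : IsBrauerian R) (hS : IsBrauerian S) :
    IsBrauerian (splitComp R S) := by
  obtain ⟨a, a1, a2, a3⟩ := hR.exists_partner
  obtain ⟨b, b1, b2, b3⟩ := hS.exists_partner
  let a' : X ⊕ (Y ⊕ Z) → X ⊕ (Y ⊕ Z) :=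
    Sum.elim (fun x => glueUpper (a (.inl x)))
      (Sum.elim (fun y => glueUpper (a (.inr y))) (fun z => .inr (.inr z)))
  let b' : X ⊕ (Y ⊕ Z) → X ⊕ (Y ⊕ Z) :=
    Sum.elim (fun x => .inl x) (fun w => .inr (b w))
  have haU : ∀ p, a' (glueUpper p) = glueUpper (a p) := by rintro (x | y) <;> rfl
  have hinj : Function.Injective (glueUpper : X ⊕ Y → X ⊕ (Y ⊕ Z)) :=
    Function.Injective.sumMap Function.injective_id Sum.inl_injective
  have hcov : ∀ w : X ⊕ (Y ⊕ Z), (∃ p, w = glueUpper p) ∨ ∃ z, w = .inr (.inr z) := by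
    rintro (x | y | z)
    · exact .inl ⟨.inl x, rfl⟩
    · exact .inl ⟨.inr y, rfl⟩
    · exact .inr ⟨z, rfl⟩
  have ha' : ∀ w, a' (a' w) = w := by
    intro w
    rcases hcov w with ⟨p, rfl⟩ | ⟨z, rfl⟩
    · rw [haU, haU, a2]
    · rfl
  have hb' : ∀ w, b' (b' w) = w := by
    rintro (x | w)
    · rfl
    · exact congrArg Sum.inr (b2 w)
  have hafix : ∀ w, a' w = w ↔ ∃ z, w = .inr (.inr z) := by
    intro w
    constructor
    · intro h
      rcases hcov w with ⟨p, rfl⟩ | h'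
      · rw [haU] at h; exact (a1 p (hinj h)).elim
      · exact h'
    · rintro ⟨z, rfl⟩; rfl
  have hbfix : ∀ w, b' w = w ↔ ∃ x, w = .inl x := by
    rintro (x | w)
    · exact ⟨fun _ => ⟨x, rfl⟩, fun _ => rfl⟩
    · refine ⟨fun h => (b1 w (Sum.inr_injective h)).elim, ?_⟩
      rintro ⟨x, h⟩; cases h
  let A : Equiv.Perm (X ⊕ (Y ⊕ Z)) := Function.Involutive.toPerm a' ha'
  let B : Equiv.Perm (X ⊕ (Y ⊕ Z)) := Function.Involutive.toPerm b' hb'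
  have hJA : ∀ w, glue R S w (A w) := by
    intro w
    rcases hcov w with ⟨p, rfl⟩ | ⟨z, rfl⟩
    · exact .rel _ _ (.inl ⟨p, a p, (a3 p (a p)).2 (.inr rfl), rfl, (haU p).symm⟩)
    · exact .refl _
  have hJB : ∀ w, glue R S w (B w) := by
    rintro (x | w)
    · exact .refl _
    · exact .rel _ _ (.inr ⟨w, b w, (b3 w (b w)).2 (.inr rfl), rfl, rfl⟩)
  have hJ : ∀ K : Setoid (X ⊕ (Y ⊕ Z)), (∀ w, K w (A w)) → (∀ w, K w (B w)) →
      ∀ p q, glue R S p q → K p q := by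
    intro K hA hB p q h
    induction h with
    | rel x y h =>
      rcases h with ⟨p, q, h, rfl, rfl⟩ | ⟨p, q, h, rfl, rfl⟩
      · rcases (a3 p q).1 h with rfl | rfl
        · exact K.refl _
        · rw [← haU]; exact hA _
      · rcases (b3 p q).1 h with rfl | rfl
        · exact K.refl _
        · exact hB (.inr p)
    | refl x => exact K.refl _
    | symm x y _ ih => exact K.symm ih
    | trans x y z _ _ ih1 ih2 => exact K.trans ih1 ih2
  have hdis : ∀ w, ¬ (a' w = w ∧ b' w = w) := by
    intro w
    rw [hafix, hbfix]
    rintro ⟨⟨z, rfl⟩, x, h⟩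
    cases h
  have hout : ∀ w : X ⊕ (Y ⊕ Z), (a' w = w ∨ b' w = w) ↔ ∃ p, w = glueOuter p := by
    intro w
    rw [hafix, hbfix]
    constructor
    · rintro (⟨z, rfl⟩ | ⟨x, rfl⟩)
      · exact ⟨.inr z, rfl⟩
      · exact ⟨.inl x, rfl⟩
    · rintro ⟨x | z, rfl⟩
      · exact .inr ⟨x, rfl⟩
      · exact .inl ⟨z, rfl⟩
  have hinjO : Function.Injective (glueOuter : X ⊕ Z → X ⊕ (Y ⊕ Z)) :=
    Function.Injective.sumMap Function.injective_id Sum.inr_injective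
  intro p
  have key : ∃! q, q ≠ glueOuter p ∧ glue R S (glueOuter p) q ∧ (a' q = q ∨ b' q = q) := by
    rcases p with x | z
    · exact dihedral_aux A B ha' hb' hdis (glue R S) hJA hJB hJ _ rfl
    · have := dihedral_aux B A hb' ha' (fun w h => hdis w h.symm) (glue R S) hJB hJA
        (fun K h1 h2 => hJ K h2 h1) (glueOuter (.inr z)) rfl
      obtain ⟨q, ⟨h1, h2, h3⟩, h4⟩ := this
      exact ⟨q, ⟨h1, h2, h3.symm⟩, fun q' h => h4 q' ⟨h.1, h.2.1, h.2.2.symm⟩⟩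
  obtain ⟨q, ⟨h1, h2, h3⟩, h4⟩ := key
  obtain ⟨q, rfl⟩ := (hout q).1 h3
  refine ⟨q, ⟨fun h => h1 (h ▸ rfl), h2⟩, ?_⟩
  rintro q' ⟨h5, h6⟩
  exact hinjO (h4 _ ⟨fun h => h5 (hinjO h), h6, (hout _).2 ⟨q', rfl⟩⟩)

theorem IsBrauerian.comap {α β : Type*} {R : Setoid β} (h : IsBrauerian R) (e : α ≃ β) :
    IsBrauerian (R.comap e) := by
  intro p
  obtain ⟨q, ⟨h1, h2⟩, h3⟩ := h (e p)
  refine ⟨e.symm q, ⟨fun h => h1 (by rw [← h]; simp), ?_⟩, ?_⟩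
  · rw [Setoid.comap_rel]; simpa using h2
  · rintro q' ⟨h4, h5⟩
    rw [Equiv.eq_symm_apply]
    exact h3 _ ⟨fun h => h4 (e.injective h), h5⟩

theorem IsBrauerian.sum {α β : Type*} {R : Setoid α} {S : Setoid β} (hR : IsBrauerian R)
    (hS : IsBrauerian S) : IsBrauerian (sumSetoid R S) := by
  rintro (p | p)
  · obtain ⟨q, ⟨h1, h2⟩, h3⟩ := hR p
    refine ⟨.inl q, ⟨fun h => h1 (Sum.inl_injective h), .inl h2⟩, ?_⟩
    rintro _ ⟨h4, h | h⟩
    exact congrArg Sum.inl (h3 _ ⟨fun h => h4 (congrArg Sum.inl h), h⟩)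
  · obtain ⟨q, ⟨h1, h2⟩, h3⟩ := hS p
    refine ⟨.inr q, ⟨fun h => h1 (Sum.inr_injective h), .inr h2⟩, ?_⟩
    rintro _ ⟨h4, h | h⟩
    exact congrArg Sum.inr (h3 _ ⟨fun h => h4 (congrArg Sum.inr h), h⟩)

theorem IsBrauerian.splitTensor {m n m' n' : ℕ} {R : SplitEquiv m n} {S : SplitEquiv m' n'}
    (hR : IsBrauerian R) (hS : IsBrauerian S) : IsBrauerian (splitTensor R S) :=
  (hR.sum hS).comap _

theorem isBrauerian_splitLines {m n : ℕ} (h : m = n) : IsBrauerian (splitLines h) := by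
  subst h
  have e : ∀ p q : Fin m ⊕ Fin m, splitLines rfl p q ↔ Sum.elim id id p = Sum.elim id id q :=
    fun _ _ => Iff.rfl
  simp only [IsBrauerian, e]
  rintro (i | i)
  · exact ⟨.inr i, by simp, by simp +contextual [eq_comm]⟩
  · exact ⟨.inl i, by simp, by simp +contextual [eq_comm]⟩

theorem isBrauerian_splitCap : IsBrauerian splitCap := by
  unfold IsBrauerian splitCap ExistsUnique
  simp only [Setoid.ker_def]
  decide

theorem isBrauerian_splitCup : IsBrauerian splitCup := by
  unfold IsBrauerian splitCup ExistsUnique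
  simp only [Setoid.ker_def]
  decide

theorem isBrauerian_splitCross : IsBrauerian splitCross := by
  unfold IsBrauerian splitCross ExistsUnique
  simp only [Setoid.ker_def]
  decide

/-! ### Reading a diagram through the labellings of its points that are constant on lines -/

/-- `φ` and `ψ` label the source and the target points so that joined points have equal labels. -/
def Labels {X Y : Type*} (R : Setoid (X ⊕ Y)) (φ : X → Prop) (ψ : Y → Prop) : Prop :=
  ∀ p q, R p q → Sum.elim φ ψ p = Sum.elim φ ψ q

theorem labels_ext {X Y : Type*} {R S : Setoid (X ⊕ Y)}
    (h : ∀ φ ψ, Labels R φ ψ ↔ Labels S φ ψ) : R = S := by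
  have aux : ∀ {R S : Setoid (X ⊕ Y)}, (∀ φ ψ, Labels S φ ψ → Labels R φ ψ) →
      ∀ p q, R p q → S p q := by
    intro R S h p q hpq
    have := h (fun x => S p (.inl x)) (fun y => S p (.inr y)) ?_ p q hpq
    · have e : ∀ w, Sum.elim (fun x => S p (.inl x)) (fun y => S p (.inr y)) w = S p w := by
        rintro (_ | _) <;> rfl
      rw [e, e] at this
      exact this ▸ S.refl p
    · intro w v hwv
      have e : ∀ w, Sum.elim (fun x => S p (.inl x)) (fun y => S p (.inr y)) w = S p w := by
        rintro (_ | _) <;> rfl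
      rw [e, e]
      exact propext ⟨fun h => S.trans h hwv, fun h => S.trans h (S.symm hwv)⟩
  ext p q
  exact ⟨aux (fun φ ψ => (h φ ψ).2) p q, aux (fun φ ψ => (h φ ψ).1) p q⟩

theorem labels_comp {X Y Z : Type*} (R : Setoid (X ⊕ Y)) (S : Setoid (Y ⊕ Z))
    (φ : X → Prop) (χ : Z → Prop) :
    Labels (splitComp R S) φ χ ↔ ∃ ψ, Labels R φ ψ ∧ Labels S ψ χ := by
  constructor
  · intro h
    let H : X ⊕ (Y ⊕ Z) → Prop := fun w => ∃ o, glue R S w (glueOuter o) ∧ Sum.elim φ χ o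
    have hH : ∀ v w, glue R S v w → H v = H w := by
      intro v w hvw
      refine propext ⟨?_, ?_⟩
      · rintro ⟨o, h1, h2⟩; exact ⟨o, (glue R S).trans ((glue R S).symm hvw) h1, h2⟩
      · rintro ⟨o, h1, h2⟩; exact ⟨o, (glue R S).trans hvw h1, h2⟩
    have hO : ∀ o, H (glueOuter o) = Sum.elim φ χ o := by
      intro o
      refine propext ⟨?_, fun h => ⟨o, (glue R S).refl _, h⟩⟩
      rintro ⟨o', h1, h2⟩
      rwa [h o o' h1]
    refine ⟨fun y => H (.inr (.inl y)), ?_, ?_⟩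
    · have e : ∀ p, Sum.elim φ (fun y => H (.inr (.inl y))) p = H (glueUpper p) := by
        rintro (x | y)
        · exact (hO (.inl x)).symm
        · rfl
      intro p q hpq
      rw [e, e]
      exact hH _ _ (.rel _ _ (.inl ⟨p, q, hpq, rfl, rfl⟩))
    · have e : ∀ p, Sum.elim (fun y => H (.inr (.inl y))) χ p = H (glueLower p) := by
        rintro (y | z)
        · rfl
        · exact (hO (.inr z)).symm
      intro p q hpq
      rw [e, e]
      exact hH _ _ (.rel _ _ (.inr ⟨p, q, hpq, rfl, rfl⟩))
  · rintro ⟨ψ, h1, h2⟩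
    have key : ∀ v w, glue R S v w → Sum.elim φ (Sum.elim ψ χ) v = Sum.elim φ (Sum.elim ψ χ) w := by
      intro v w h
      induction h with
      | rel x y h =>
        rcases h with ⟨p, q, h, rfl, rfl⟩ | ⟨p, q, h, rfl, rfl⟩
        · have e : ∀ p, Sum.elim φ (Sum.elim ψ χ) (glueUpper p) = Sum.elim φ ψ p := by
            rintro (_ | _) <;> rfl
          rw [e, e]; exact h1 p q h
        · exact h2 p q h
      | refl x => rfl
      | symm x y _ ih => exact ih.symm
      | trans x y z _ _ ih1 ih2 => exact ih1.trans ih2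
    intro p q h
    have e : ∀ p, Sum.elim φ (Sum.elim ψ χ) (glueOuter p) = Sum.elim φ χ p := by
      rintro (_ | _) <;> rfl
    rw [← e, ← e]
    exact key _ _ h

theorem labels_tensor {m n m' n' : ℕ} (R : SplitEquiv m n) (S : SplitEquiv m' n')
    (φ : Fin (m + m') → Prop) (ψ : Fin (n + n') → Prop) :
    Labels (splitTensor R S) φ ψ ↔
      Labels R (fun i => φ (Fin.castAdd m' i)) (fun i => ψ (Fin.castAdd n' i)) ∧
      Labels S (fun i => φ (Fin.natAdd m i)) (fun i => ψ (Fin.natAdd n i)) := by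
  have e : ∀ p, Sum.elim φ ψ ((splitPoints m n m' n').symm p) =
      Sum.elim (Sum.elim (fun i => φ (Fin.castAdd m' i)) (fun i => ψ (Fin.castAdd n' i)))
        (Sum.elim (fun i => φ (Fin.natAdd m i)) (fun i => ψ (Fin.natAdd n i))) p := by
    rintro ((_ | _) | (_ | _)) <;> rfl
  constructor
  · intro h
    constructor
    · intro p q hpq
      have := h ((splitPoints m n m' n').symm (.inl p)) ((splitPoints m n m' n').symm (.inl q))
        (by
          rw [splitTensor, Setoid.comap_rel, Equiv.apply_symm_apply, Equiv.apply_symm_apply]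
          exact Sum.LiftRel.inl hpq)
      simpa only [e, Sum.elim_inl] using this
    · intro p q hpq
      have := h ((splitPoints m n m' n').symm (.inr p)) ((splitPoints m n m' n').symm (.inr q))
        (by
          rw [splitTensor, Setoid.comap_rel, Equiv.apply_symm_apply, Equiv.apply_symm_apply]
          exact Sum.LiftRel.inr hpq)
      simpa only [e, Sum.elim_inr] using this
  · rintro ⟨h1, h2⟩ p q hpq
    obtain ⟨p, rfl⟩ := (splitPoints m n m' n').symm.surjective p
    obtain ⟨q, rfl⟩ := (splitPoints m n m' n').symm.surjective q
    rw [splitTensor, Setoid.comap_rel, Equiv.apply_symm_apply, Equiv.apply_symm_apply] at hpq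
    rw [e, e]
    rcases hpq with h | h
    · exact h1 _ _ h
    · exact h2 _ _ h

theorem labels_lines {m n : ℕ} (h : m = n) (φ : Fin m → Prop) (ψ : Fin n → Prop) :
    Labels (splitLines h) φ ψ ↔ φ = fun i => ψ (Fin.cast h i) := by
  subst h
  constructor
  · intro h
    funext i
    exact h (.inl i) (.inr i) rfl
  · rintro rfl
    have e : ∀ p, Sum.elim (fun i => ψ (Fin.cast rfl i)) ψ p =
        ψ (Sum.elim (Fin.cast rfl) id p) := by rintro (_ | _) <;> rfl
    intro p q hpq
    rw [e, e]
    exact congrArg ψ hpq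

theorem labels_cap (φ : Fin 0 → Prop) (ψ : Fin 2 → Prop) :
    Labels splitCap φ ψ ↔ ψ 0 = ψ 1 := by
  constructor
  · intro h; exact h (.inr 0) (.inr 1) rfl
  · intro h p q _
    rcases p with i | i
    · exact i.elim0
    rcases q with j | j
    · exact j.elim0
    fin_cases i <;> fin_cases j <;> simp [h]

theorem labels_cup (φ : Fin 4 → Prop) (ψ : Fin 2 → Prop) :
    Labels splitCup φ ψ ↔ φ 1 = φ 2 ∧ φ 0 = ψ 0 ∧ φ 3 = ψ 1 := by
  constructor
  · intro h
    exact ⟨h (.inl 1) (.inl 2) rfl, h (.inl 0) (.inr 0) rfl, h (.inl 3) (.inr 1) rfl⟩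
  · rintro ⟨h1, h2, h3⟩ p q hpq
    rw [splitCup, Setoid.ker_def] at hpq
    rcases p with i | i <;> rcases q with j | j <;> fin_cases i <;> fin_cases j <;>
      simp_all

theorem labels_cross (φ ψ : Fin 2 → Prop) :
    Labels splitCross φ ψ ↔ φ 0 = ψ 1 ∧ φ 1 = ψ 0 := by
  constructor
  · intro h
    exact ⟨h (.inl 0) (.inr 1) rfl, h (.inl 1) (.inr 0) rfl⟩
  · rintro ⟨h1, h2⟩ p q hpq
    rw [splitCross, Setoid.ker_def] at hpq
    rcases p with i | i <;> rcases q with j | j <;> fin_cases i <;> fin_cases j <;>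
      simp_all

/-! ### The category `Br` -/

/-- The category `Br`: the objects are the finite ordinals. -/
def Br : Type := ℕ

/-- The arrows of `Br` are the Brauerian split equivalences. -/
@[ext] structure BrHom (m n : ℕ) : Type where
  rel : SplitEquiv m n
  brauerian : IsBrauerian rel

namespace BrHom

/-- Vertical composition, upper diagram first. -/
def comp {m n k : ℕ} (R : BrHom m n) (S : BrHom n k) : BrHom m k :=
  ⟨splitComp R.rel S.rel, R.brauerian.splitComp S.brauerian⟩

/-- Horizontal composition. -/
def tensor {m n m' n' : ℕ} (R : BrHom m n) (S : BrHom m' n') : BrHom (m + m') (n + n') :=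
  ⟨splitTensor R.rel S.rel, R.brauerian.splitTensor S.brauerian⟩

/-- Parallel vertical lines. -/
def lines {m n : ℕ} (h : m = n) : BrHom m n := ⟨splitLines h, isBrauerian_splitLines h⟩

/-- The diagram of `r`. -/
def cap : BrHom 0 2 := ⟨splitCap, isBrauerian_splitCap⟩

/-- The diagram of `t`. -/
def cup : BrHom (2 + 2) 2 := ⟨splitCup, isBrauerian_splitCup⟩

/-- The diagram of `s`. -/
def cross : BrHom 2 2 := ⟨splitCross, isBrauerian_splitCross⟩

/-- The labellings of a diagram. -/
def Lab {m n : ℕ} (R : BrHom m n) (φ : Fin m → Prop) (ψ : Fin n → Prop) : Prop :=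
  Labels R.rel φ ψ

theorem ext_lab {m n : ℕ} {R S : BrHom m n} (h : ∀ φ ψ, R.Lab φ ψ ↔ S.Lab φ ψ) : R = S :=
  BrHom.ext (labels_ext h)

theorem lab_comp {m n k : ℕ} (R : BrHom m n) (S : BrHom n k) (φ : Fin m → Prop)
    (χ : Fin k → Prop) : (R.comp S).Lab φ χ ↔ ∃ ψ, R.Lab φ ψ ∧ S.Lab ψ χ :=
  labels_comp _ _ _ _

theorem lab_tensor {m n m' n' : ℕ} (R : BrHom m n) (S : BrHom m' n')
    (φ : Fin (m + m') → Prop) (ψ : Fin (n + n') → Prop) :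
    (R.tensor S).Lab φ ψ ↔
      R.Lab (fun i => φ (Fin.castAdd m' i)) (fun i => ψ (Fin.castAdd n' i)) ∧
      S.Lab (fun i => φ (Fin.natAdd m i)) (fun i => ψ (Fin.natAdd n i)) :=
  labels_tensor _ _ _ _

theorem lab_lines {m n : ℕ} (h : m = n) (φ : Fin m → Prop) (ψ : Fin n → Prop) :
    (lines h).Lab φ ψ ↔ φ = fun i => ψ (Fin.cast h i) :=
  labels_lines _ _ _

theorem lines_comp {m n k : ℕ} (h : m = n) (S : BrHom n k) (φ : Fin m → Prop)
    (χ : Fin k → Prop) :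
    ((lines h).comp S).Lab φ χ ↔ S.Lab (fun i => φ (Fin.cast h.symm i)) χ := by
  subst h
  simp [lab_comp, lab_lines]

theorem comp_lines {m n k : ℕ} (R : BrHom m n) (h : n = k) (φ : Fin m → Prop)
    (χ : Fin k → Prop) :
    (R.comp (lines h)).Lab φ χ ↔ R.Lab φ (fun i => χ (Fin.cast h i)) := by
  subst h
  simp [lab_comp, lab_lines]

theorem lines_comp_lines {m n k : ℕ} (h : m = n) (h' : n = k) :
    (lines h).comp (lines h') = lines (h.trans h') := by
  subst h h'
  exact ext_lab fun φ χ => by simp [lines_comp]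

theorem lines_tensor_lines {m n m' n' : ℕ} (h : m = n) (h' : m' = n') :
    (lines h).tensor (lines h') = lines (congrArg₂ (· + ·) h h') := by
  subst h h'
  refine ext_lab fun φ ψ => ?_
  rw [lab_tensor, lab_lines, lab_lines, lab_lines]
  constructor
  · rintro ⟨h1, h2⟩
    funext i
    refine Fin.addCases (fun i => ?_) (fun i => ?_) i
    · exact congrFun h1 i
    · exact congrFun h2 i
  · rintro rfl
    exact ⟨rfl, rfl⟩

/-- A diagram that consists of parallel vertical lines only. -/
def IsLines {m n : ℕ} (R : BrHom m n) : Prop := ∃ h : m = n, R = lines h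

theorem IsLines.comp {m n k : ℕ} {R : BrHom m n} {S : BrHom n k} (hR : R.IsLines)
    (hS : S.IsLines) : (R.comp S).IsLines := by
  obtain ⟨h, rfl⟩ := hR
  obtain ⟨h', rfl⟩ := hS
  exact ⟨_, lines_comp_lines h h'⟩

theorem IsLines.tensor {m n m' n' : ℕ} {R : BrHom m n} {S : BrHom m' n'} (hR : R.IsLines)
    (hS : S.IsLines) : (R.tensor S).IsLines := by
  obtain ⟨h, rfl⟩ := hR
  obtain ⟨h', rfl⟩ := hS
  exact ⟨_, lines_tensor_lines h h'⟩

theorem isLines_lines {m n : ℕ} (h : m = n) : (lines h).IsLines := ⟨h, rfl⟩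

theorem IsLines.eq {m n : ℕ} {R S : BrHom m n} (hR : R.IsLines) (hS : S.IsLines) : R = S := by
  obtain ⟨h, rfl⟩ := hR
  obtain ⟨h', rfl⟩ := hS
  rfl

theorem id_comp {m n : ℕ} (R : BrHom m n) : (lines rfl).comp R = R :=
  ext_lab fun φ ψ => by simp [lines_comp]

theorem comp_id {m n : ℕ} (R : BrHom m n) : R.comp (lines rfl) = R :=
  ext_lab fun φ ψ => by simp [comp_lines]

theorem assoc {m n k l : ℕ} (R : BrHom m n) (S : BrHom n k) (T : BrHom k l) :
    (R.comp S).comp T = R.comp (S.comp T) :=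
  ext_lab fun φ ψ => by
    simp only [lab_comp]
    constructor
    · rintro ⟨a, ⟨b, h1, h2⟩, h3⟩; exact ⟨b, h1, a, h2, h3⟩
    · rintro ⟨b, h1, a, h2, h3⟩; exact ⟨a, ⟨b, h1, h2⟩, h3⟩

theorem comp_tensor_comp {m n k m' n' k' : ℕ} (R : BrHom m n) (S : BrHom n k)
    (R' : BrHom m' n') (S' : BrHom n' k') :
    (R.comp S).tensor (R'.comp S') = (R.tensor R').comp (S.tensor S') :=
  ext_lab fun φ ψ => by
    simp only [lab_comp, lab_tensor]
    constructor
    · rintro ⟨⟨a, h1, h2⟩, b, h3, h4⟩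
      refine ⟨Fin.append a b, ?_⟩
      simp only [Fin.append_left, Fin.append_right]
      exact ⟨⟨h1, h3⟩, h2, h4⟩
    · rintro ⟨a, ⟨h1, h3⟩, h2, h4⟩
      exact ⟨⟨_, h1, h2⟩, _, h3, h4⟩

theorem tensor_assoc {m n m' n' m'' n'' : ℕ} (R : BrHom m n) (S : BrHom m' n')
    (T : BrHom m'' n'') :
    (lines (Nat.add_assoc m m' m'').symm).comp ((R.tensor S).tensor T) =
      (R.tensor (S.tensor T)).comp (lines (Nat.add_assoc n n' n'').symm) :=
  ext_lab fun φ ψ => by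
    rw [lines_comp, comp_lines]
    simp only [lab_tensor]
    rw [and_assoc]
    have e' : ∀ (a b c : ℕ) (i : Fin c), Fin.natAdd (a + b) i =
      Fin.cast (Nat.add_assoc a b c).symm (Fin.natAdd a (Fin.natAdd b i)) := fun a b c i =>
        Fin.ext (Nat.add_assoc a b i)
    simp only [e']
    rfl

theorem tensor_unit {m n : ℕ} (R : BrHom m n) :
    (lines (Nat.add_zero m)).comp R =
      (R.tensor (lines (rfl : 0 = 0))).comp (lines (Nat.add_zero n)) :=
  ext_lab fun φ ψ => by
    rw [lines_comp, comp_lines, lab_tensor, lab_lines]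
    exact ⟨fun h => ⟨h, funext fun i => i.elim0⟩, fun h => h.1⟩

theorem unit_tensor {m n : ℕ} (R : BrHom m n) :
    (lines (Nat.zero_add m)).comp R =
      ((lines (rfl : 0 = 0)).tensor R).comp (lines (Nat.zero_add n)) :=
  ext_lab fun φ ψ => by
    have e' : ∀ (c : ℕ) (i : Fin c), Fin.natAdd 0 i = Fin.cast (Nat.zero_add c).symm i :=
      fun c i => Fin.ext (Nat.zero_add i)
    rw [lines_comp, comp_lines, lab_tensor, lab_lines]
    simp only [e']
    exact ⟨fun h => ⟨funext fun i => i.elim0, h⟩, fun h => h.2⟩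

theorem cap_cup_right :
    ((lines (rfl : 2 = 2)).tensor cap).comp cup = lines (Nat.add_zero 2) :=
  ext_lab fun φ ψ => by
    rw [lab_comp, lab_lines]
    constructor
    · rintro ⟨a, h1, h2⟩
      rw [lab_tensor, lab_lines] at h1
      have h3 := (labels_cap _ _).1 h1.2
      obtain ⟨h4, h5, h6⟩ := (labels_cup _ _).1 h2
      have h7 := congrFun h1.1 0
      have h8 := congrFun h1.1 1
      funext i
      fin_cases i
      · exact h7.trans h5
      · exact h8.trans (h4.trans (h3.trans h6))
    · rintro rfl
      refine ⟨![ψ 0, ψ 1, ψ 1, ψ 1], ?_, (labels_cup _ _).2 ⟨rfl, rfl, rfl⟩⟩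
      rw [lab_tensor, lab_lines]
      refine ⟨?_, (labels_cap _ _).2 rfl⟩
      funext i
      fin_cases i <;> rfl

theorem cap_cup_left :
    (cap.tensor (lines (rfl : 2 = 2))).comp cup = lines (Nat.zero_add 2) :=
  ext_lab fun φ ψ => by
    rw [lab_comp, lab_lines]
    constructor
    · rintro ⟨a, h1, h2⟩
      rw [lab_tensor, lab_lines] at h1
      have h3 := (labels_cap _ _).1 h1.1
      obtain ⟨h4, h5, h6⟩ := (labels_cup _ _).1 h2
      have h7 := congrFun h1.2 0
      have h8 := congrFun h1.2 1
      funext i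
      fin_cases i
      · exact h7.trans (h4.symm.trans (h3.symm.trans h5))
      · exact h8.trans h6
    · rintro rfl
      refine ⟨![ψ 0, ψ 0, ψ 0, ψ 1], ?_, (labels_cup _ _).2 ⟨rfl, rfl, rfl⟩⟩
      rw [lab_tensor, lab_lines]
      refine ⟨(labels_cap _ _).2 rfl, ?_⟩
      funext i
      fin_cases i <;> rfl

theorem cup_assoc :
    ((lines (rfl : 2 = 2)).tensor cup).comp cup =
      (lines (Nat.add_assoc 2 2 2).symm).comp
        ((cup.tensor (lines (rfl : 2 = 2))).comp cup) :=
  ext_lab fun φ ψ => by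
    rw [lines_comp, lab_comp, lab_comp]
    constructor
    · rintro ⟨a, h1, h2⟩
      rw [lab_tensor, lab_lines] at h1
      obtain ⟨h3, h4, h5⟩ := (labels_cup _ _).1 h1.2
      obtain ⟨h6, h7, h8⟩ := (labels_cup _ _).1 h2
      have h9 := congrFun h1.1 0
      have h10 := congrFun h1.1 1
      refine ⟨![φ 0, φ 3, φ 4, φ 5], ?_, (labels_cup _ _).2 ⟨?_, ?_, ?_⟩⟩
      · rw [lab_tensor, lab_lines]
        refine ⟨(labels_cup _ _).2 ⟨?_, rfl, rfl⟩, ?_⟩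
        · exact h10.trans (h6.trans h4.symm)
        · funext i
          fin_cases i <;> rfl
      · exact h3
      · exact h9.trans h7
      · exact h5.trans h8
    · rintro ⟨a, h1, h2⟩
      rw [lab_tensor, lab_lines] at h1
      obtain ⟨h3, h4, h5⟩ := (labels_cup _ _).1 h1.1
      obtain ⟨h6, h7, h8⟩ := (labels_cup _ _).1 h2
      have h9 := congrFun h1.2 0
      have h10 := congrFun h1.2 1
      refine ⟨![φ 0, φ 1, φ 2, φ 5], ?_, (labels_cup _ _).2 ⟨?_, ?_, ?_⟩⟩
      · rw [lab_tensor, lab_lines]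
        refine ⟨?_, (labels_cup _ _).2 ⟨?_, rfl, rfl⟩⟩
        · funext i
          fin_cases i <;> rfl
        · exact h5.trans (h6.trans h9.symm)
      · exact h3
      · exact h4.trans h7
      · exact h10.trans h8

theorem cross_cross : cross.comp cross = lines rfl :=
  ext_lab fun φ ψ => by
    rw [lab_comp, lab_lines]
    constructor
    · rintro ⟨a, h1, h2⟩
      obtain ⟨h3, h4⟩ := (labels_cross _ _).1 h1
      obtain ⟨h5, h6⟩ := (labels_cross _ _).1 h2
      funext i
      fin_cases i
      · exact h3.trans h6
      · exact h4.trans h5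
    · rintro rfl
      exact ⟨![ψ 1, ψ 0], (labels_cross _ _).2 ⟨rfl, rfl⟩, (labels_cross _ _).2 ⟨rfl, rfl⟩⟩

theorem cap_cross : cap.comp cross = cap :=
  ext_lab fun φ ψ => by
    rw [lab_comp]
    constructor
    · rintro ⟨a, h1, h2⟩
      have h0 := (labels_cap _ _).1 h1
      obtain ⟨h3, h4⟩ := (labels_cross _ _).1 h2
      exact (labels_cap _ _).2 (h4.symm.trans (h0.symm.trans h3))
    · intro h
      have h0 := (labels_cap _ _).1 h
      exact ⟨![ψ 1, ψ 0], (labels_cap _ _).2 h0.symm, (labels_cross _ _).2 ⟨rfl, rfl⟩⟩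

end BrHom

instance Br.category : Category Br where
  Hom m n := BrHom m n
  id m := BrHom.lines (rfl : m = m)
  comp R S := R.comp S
  id_comp R := R.id_comp
  comp_id R := R.comp_id
  assoc R S T := R.assoc S T

/-! ## The category `M_≡` -/

universe u

/-- Formulae over the set `V` of variables: `x ≡ y`, `⊤` and `A ∧ B`. -/
inductive Formula (V : Type u) : Type u
  | eqv (x y : V) : Formula V
  | top : Formula V
  | conj (A B : Formula V) : Formula V

namespace Formula

/-- The number of occurrences of variables in a formula. -/
def occ {V : Type u} : Formula V → ℕ
  | eqv _ _ => 2
  | top => 0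
  | conj A B => A.occ + B.occ

end Formula

open Formula in
/-- Arrow terms of `M_≡`; `Term A B` consists of the arrow terms of type `A ⊢ B`. -/
inductive Term {V : Type u} : Formula V → Formula V → Type u
  | id (A) : Term A A
  | bTo (A B C) : Term (conj A (conj B C)) (conj (conj A B) C)
  | bFrom (A B C) : Term (conj (conj A B) C) (conj A (conj B C))
  | dTo (A) : Term (conj A top) A
  | dFrom (A) : Term A (conj A top)
  | sigTo (A) : Term (conj top A) A
  | sigFrom (A) : Term A (conj top A)
  | r (x) : Term top (eqv x x)
  | t (x y z) : Term (conj (eqv x y) (eqv y z)) (eqv x z)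
  | s (x y) : Term (eqv x y) (eqv y x)
  | wedge {A B C D} (f : Term A B) (g : Term C D) : Term (conj A C) (conj B D)
  | comp {A B C} (g : Term B C) (f : Term A B) : Term A C

namespace Term

open Formula

/-- Equality of arrow terms in `M_≡`: the smallest congruence on arrow terms that satisfies the
equations of `M_≡`. Here `g.comp f` is the composition of `f` followed by `g`. -/
inductive Eqv {V : Type u} : {A B : Formula V} → Term A B → Term A B → Prop
  | refl {A B} (f : Term A B) : Eqv f f
  | symm {A B} {f g : Term A B} : Eqv f g → Eqv g f
  | trans {A B} {f g h : Term A B} : Eqv f g → Eqv g h → Eqv f h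
  | congr_wedge {A B C D} {f₁ g₁ : Term A B} {f₂ g₂ : Term C D} :
      Eqv f₁ g₁ → Eqv f₂ g₂ → Eqv (f₁.wedge f₂) (g₁.wedge g₂)
  | congr_comp {A B C} {f₁ g₁ : Term A B} {f₂ g₂ : Term B C} :
      Eqv f₁ g₁ → Eqv f₂ g₂ → Eqv (f₂.comp f₁) (g₂.comp g₁)
  | cat_one_left {A B} (f : Term A B) : Eqv ((id B).comp f) f
  | cat_one_right {A B} (f : Term A B) : Eqv (f.comp (id A)) f
  | cat_two {A B C D} (f : Term A B) (g : Term B C) (h : Term C D) :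
      Eqv ((h.comp g).comp f) (h.comp (g.comp f))
  | wedge_one (A B) : Eqv ((id A).wedge (id B)) (id (conj A B))
  | wedge_two {A B C A' B' C'} (f₁ : Term A B) (g₁ : Term B C) (f₂ : Term A' B')
      (g₂ : Term B' C') :
      Eqv ((g₁.comp f₁).wedge (g₂.comp f₂)) ((g₁.wedge g₂).comp (f₁.wedge f₂))
  | b_nat {A B C D E F} (f : Term A D) (g : Term B E) (h : Term C F) :
      Eqv (((f.wedge g).wedge h).comp (bTo A B C)) ((bTo D E F).comp (f.wedge (g.wedge h)))
  | d_nat {A D} (f : Term A D) : Eqv (f.comp (dTo A)) ((dTo D).comp (f.wedge (id top)))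
  | sig_nat {A D} (f : Term A D) : Eqv (f.comp (sigTo A)) ((sigTo D).comp ((id top).wedge f))
  | bb_left (A B C) : Eqv ((bFrom A B C).comp (bTo A B C)) (id (conj A (conj B C)))
  | bb_right (A B C) : Eqv ((bTo A B C).comp (bFrom A B C)) (id (conj (conj A B) C))
  | b_five (A B C D) :
      Eqv ((bTo (conj A B) C D).comp (bTo A B (conj C D)))
        (((bTo A B C).wedge (id D)).comp
          ((bTo A (conj B C) D).comp ((id A).wedge (bTo B C D))))
  | dd_left (A) : Eqv ((dFrom A).comp (dTo A)) (id (conj A top))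
  | dd_right (A) : Eqv ((dTo A).comp (dFrom A)) (id A)
  | sigsig_left (A) : Eqv ((sigFrom A).comp (sigTo A)) (id (conj top A))
  | sigsig_right (A) : Eqv ((sigTo A).comp (sigFrom A)) (id A)
  | b_d_sig (A C) :
      Eqv (bTo A top C) (((dFrom A).wedge (id C)).comp ((id A).wedge (sigTo C)))
  | r_t_d (x y) : Eqv ((t x y y).comp ((id (eqv x y)).wedge (r y))) (dTo (eqv x y))
  | r_t_sig (x y) : Eqv ((t y y x).comp ((r y).wedge (id (eqv y x)))) (sigTo (eqv y x))
  | t_b (x y z w) :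
      Eqv ((t x y w).comp ((id (eqv x y)).wedge (t y z w)))
        ((t x z w).comp (((t x y z).wedge (id (eqv z w))).comp
          (bTo (eqv x y) (eqv y z) (eqv z w))))
  | s_s (x y) : Eqv ((s y x).comp (s x y)) (id (eqv x y))
  | r_s (x) : Eqv ((s x x).comp (r x)) (r x)

/-- The equivalence relation on arrow terms of type `A ⊢ B`. -/
instance setoid {V : Type u} (A B : Formula V) : Setoid (Term A B) where
  r := Eqv
  iseqv := ⟨.refl, .symm, .trans⟩

/-- The diagram of an arrow term. -/
def diagram {V : Type u} : {A B : Formula V} → Term A B → BrHom A.occ B.occ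
  | _, _, id _ => .lines rfl
  | _, _, bTo A B C => .lines (Nat.add_assoc A.occ B.occ C.occ).symm
  | _, _, bFrom A B C => .lines (Nat.add_assoc A.occ B.occ C.occ)
  | _, _, dTo A => .lines (Nat.add_zero A.occ)
  | _, _, dFrom A => .lines (Nat.add_zero A.occ).symm
  | _, _, sigTo A => .lines (Nat.zero_add A.occ)
  | _, _, sigFrom A => .lines (Nat.zero_add A.occ).symm
  | _, _, r _ => .cap
  | _, _, t _ _ _ => .cup
  | _, _, s _ _ => .cross
  | _, _, wedge f g => f.diagram.tensor g.diagram
  | _, _, comp g f => f.diagram.comp g.diagram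

theorem Eqv.diagram_eq {V : Type u} {A B : Formula V} {f g : Term A B} (h : Eqv f g) :
    f.diagram = g.diagram := by
  induction h with
  | refl f => rfl
  | symm _ ih => exact ih.symm
  | trans _ _ ih1 ih2 => exact ih1.trans ih2
  | congr_wedge _ _ ih1 ih2 => exact congrArg₂ BrHom.tensor ih1 ih2
  | congr_comp _ _ ih1 ih2 => exact congrArg₂ BrHom.comp ih1 ih2
  | cat_one_left f => exact f.diagram.comp_id
  | cat_one_right f => exact f.diagram.id_comp
  | cat_two f g h => exact (f.diagram.assoc g.diagram h.diagram).symm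
  | wedge_one A B => exact BrHom.lines_tensor_lines rfl rfl
  | wedge_two f₁ g₁ f₂ g₂ => exact BrHom.comp_tensor_comp _ _ _ _
  | b_nat f g h => exact BrHom.tensor_assoc _ _ _
  | d_nat f => exact BrHom.tensor_unit _
  | sig_nat f => exact BrHom.unit_tensor _
  | r_t_d x y => exact BrHom.cap_cup_right
  | r_t_sig x y => exact BrHom.cap_cup_left
  | t_b x y z w => exact BrHom.cup_assoc.trans (BrHom.assoc _ _ _).symm
  | s_s x y => exact BrHom.cross_cross
  | r_s x => exact BrHom.cap_cross
  | bb_left A B C => exact BrHom.lines_comp_lines _ _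
  | bb_right A B C => exact BrHom.lines_comp_lines _ _
  | b_five A B C D =>
    exact BrHom.IsLines.eq (.comp (BrHom.isLines_lines _) (BrHom.isLines_lines _))
      (.comp (.comp (.tensor (BrHom.isLines_lines _) (BrHom.isLines_lines _)) (BrHom.isLines_lines _))
        (.tensor (BrHom.isLines_lines _) (BrHom.isLines_lines _)))
  | dd_left A => exact BrHom.lines_comp_lines _ _
  | dd_right A => exact BrHom.lines_comp_lines _ _
  | sigsig_left A => exact BrHom.lines_comp_lines _ _
  | sigsig_right A => exact BrHom.lines_comp_lines _ _
  | b_d_sig A C =>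
    exact BrHom.IsLines.eq (BrHom.isLines_lines _)
      (.comp (.tensor (BrHom.isLines_lines _) (BrHom.isLines_lines _))
        (.tensor (BrHom.isLines_lines _) (BrHom.isLines_lines _)))

end Term

/-- The category `M_≡` over the set `V` of variables: the objects are the formulae. -/
def MEq (V : Type u) : Type u := Formula V

namespace MEq

/-- The arrows are equivalence classes of arrow terms. -/
instance category (V : Type u) : Category.{u} (MEq V) where
  Hom A B := Quotient (Term.setoid (V := V) A B)
  id A := Quotient.mk _ (Term.id A)
  comp f g := Quotient.map₂ (fun f g => Term.comp g f) (fun _ _ h _ _ h' => .congr_comp h h') f g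
  id_comp := by rintro A B ⟨f⟩; exact Quotient.sound (.cat_one_right f)
  comp_id := by rintro A B ⟨f⟩; exact Quotient.sound (.cat_one_left f)
  assoc := by rintro A B C D ⟨f⟩ ⟨g⟩ ⟨h⟩; exact Quotient.sound (.symm (.cat_two f g h))

/-- The arrow of `M_≡` denoted by an arrow term. -/
def arrow {V : Type u} {A B : MEq V} (f : Term (V := V) A B) : A ⟶ B := Quotient.mk _ f

theorem sound {V : Type u} {A B : MEq V} {f g : Term (V := V) A B} (h : Term.Eqv f g) :
    arrow f = arrow g := Quotient.sound h

/-- The operation `∧` on the objects. -/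
def conj {V : Type u} (A B : MEq V) : MEq V := Formula.conj A B

/-- The operation `∧` on the arrows. -/
def wedge {V : Type u} {A B C D : MEq V} (f : A ⟶ B) (g : C ⟶ D) : conj A C ⟶ conj B D :=
  Quotient.map₂ Term.wedge (fun _ _ h _ _ h' => Term.Eqv.congr_wedge h h') f g

theorem wedge_id {V : Type u} (A B : MEq V) : wedge (𝟙 A) (𝟙 B) = 𝟙 (conj A B) :=
  sound (.wedge_one A B)

theorem wedge_comp {V : Type u} {A B C A' B' C' : MEq V} (f₁ : A ⟶ B) (g₁ : B ⟶ C)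
    (f₂ : A' ⟶ B') (g₂ : B' ⟶ C') :
    wedge f₁ f₂ ≫ wedge g₁ g₂ = wedge (f₁ ≫ g₁) (f₂ ≫ g₂) := by
  obtain ⟨f₁⟩ := f₁
  obtain ⟨g₁⟩ := g₁
  obtain ⟨f₂⟩ := f₂
  obtain ⟨g₂⟩ := g₂
  exact sound (.symm (.wedge_two f₁ g₁ f₂ g₂))

/-- The operation `∧` on isomorphisms. -/
def wedgeIso {V : Type u} {A B C D : MEq V} (e : A ≅ B) (e' : C ≅ D) : conj A C ≅ conj B D where
  hom := wedge e.hom e'.hom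
  inv := wedge e.inv e'.inv
  hom_inv_id := by rw [wedge_comp, e.hom_inv_id, e'.hom_inv_id, wedge_id]
  inv_hom_id := by rw [wedge_comp, e.inv_hom_id, e'.inv_hom_id, wedge_id]

/-- The isomorphism given by `b`. -/
def bIso {V : Type u} (A B C : MEq V) : conj (conj A B) C ≅ conj A (conj B C) where
  hom := arrow (.bFrom A B C)
  inv := arrow (.bTo A B C)
  hom_inv_id := sound (.bb_right A B C)
  inv_hom_id := sound (.bb_left A B C)

/-- The isomorphism given by `σ`. -/
def sigIso {V : Type u} (A : MEq V) : conj (Formula.top : Formula V) A ≅ A where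
  hom := arrow (.sigTo A)
  inv := arrow (.sigFrom A)
  hom_inv_id := sound (.sigsig_left A)
  inv_hom_id := sound (.sigsig_right A)

/-- The isomorphism given by `δ`. -/
def dIso {V : Type u} (A : MEq V) : conj A (Formula.top : Formula V) ≅ A where
  hom := arrow (.dTo A)
  inv := arrow (.dFrom A)
  hom_inv_id := sound (.dd_left A)
  inv_hom_id := sound (.dd_right A)

/-- `M_≡` is a monoidal category. -/
instance monoidal (V : Type u) : MonoidalCategory (MEq V) where
  tensorObj A B := conj A B
  tensorUnit := (Formula.top : Formula V)
  tensorHom f g := wedge f g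
  whiskerLeft A _ _ f := wedge (𝟙 A) f
  whiskerRight f A := wedge f (𝟙 A)
  associator A B C := bIso A B C
  leftUnitor A := sigIso A
  rightUnitor A := dIso A
  tensorHom_def f g := by rw [wedge_comp, Category.comp_id, Category.id_comp]
  id_tensorHom_id A B := wedge_id A B
  tensorHom_comp_tensorHom f g h k := wedge_comp f h g k
  whiskerLeft_id A B := wedge_id A B
  id_whiskerRight A B := wedge_id A B
  associator_naturality f g h := by
    rw [← Iso.eq_comp_inv, Category.assoc, ← Iso.inv_comp_eq]
    obtain ⟨f⟩ := f
    obtain ⟨g⟩ := g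
    obtain ⟨h⟩ := h
    exact sound (.b_nat f g h)
  leftUnitor_naturality f := by
    obtain ⟨f⟩ := f
    exact sound (.symm (.sig_nat f))
  rightUnitor_naturality f := by
    obtain ⟨f⟩ := f
    exact sound (.symm (.d_nat f))
  pentagon A B C D := by
    have h : (wedgeIso (bIso A B C) (Iso.refl D) ≪≫ bIso A (conj B C) D ≪≫
        wedgeIso (Iso.refl A) (bIso B C D)).inv =
          (bIso (conj A B) C D ≪≫ bIso A B (conj C D)).inv :=
      (sound (.b_five A B C D)).symm
    exact congrArg Iso.hom (Iso.ext_inv h)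
  triangle A B := by
    have h : (bIso A (Formula.top : Formula V) B).inv =
        (wedgeIso (Iso.refl A) (sigIso B)).hom ≫ (wedgeIso (dIso A) (Iso.refl B)).inv :=
      sound (.b_d_sig A B)
    rw [Iso.eq_comp_inv, Iso.inv_comp_eq] at h
    exact h.symm

/-- The functor `G` from `M_≡` to `Br`: a formula goes to the number of occurrences of variables
in it, and the arrow denoted by an arrow term goes to the diagram of this arrow term. -/
def G (V : Type u) : MEq V ⥤ Br where
  obj A := Formula.occ A
  map f := Quotient.lift Term.diagram (fun _ _ h => Term.Eqv.diagram_eq h) f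
  map_id _ := rfl
  map_comp := by rintro A B C ⟨f⟩ ⟨g⟩; rfl

end MEq

/-! Every arrow is brought to a normal form that can be read off its diagram. The monoidal structure
first replaces a formula by the list of its atomic conjuncts (`flatIso`). The structural arrows then
become identities, and only `r`, `t` and `s` remain. An arrow between two such lists is a forest:
the source is cut into consecutive blocks, each block is multiplied by `t` and `s` into one conjunct
of the target, and the other conjuncts of the target come from `r`. Forests are closed under
postcomposition with all arrow terms (`preservesForests_flatArrow`). The unit laws, `s ∘ s = 1` and
`s ∘ r = r` serve to remove superfluous occurrences of `r` and `s`.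

A tree is recorded by a word of letters, which are positions of source atoms with an orientation.
Multiplication by `t` concatenates words, and `s` reverses the word and all its orientations. The
word determines the arrow (`IsTree.unique`). Trees differ only in the bracketing of products, and
this is absorbed by the associativity of `t`. Whether the outermost product is inverted is visible
in the word: a cut into smaller positions followed by larger ones excludes an outermost inversion.
The argument is the one by which separable permutations have unique decompositions into direct and
skew sums.

The diagram determines the words (`Linked.unique`). From the left target point of a conjunct, follow
the line to its other end. If this is a source point, it belongs to the first letter of the word and
shows its orientation. Jump to the other variable of the same atom, follow its line, and so on,
until the right target point is reached. The two-element classes of a Brauerian diagram make each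
step unique.

Lists grow at the head, which is the rightmost conjunct. The position of an atom is the length of
the tail below it, so it does not change when conjuncts are added on the right. -/

open MonoidalCategory

/-! ### Lists of atoms, and the equations for `r`, `t` and `s` -/

namespace MEq

variable {V : Type u}

/-- The atomic formula `x ≡ y` as an object of `M_≡`. -/
def atom (x y : V) : MEq V := Formula.eqv x y

/-- The conjunction of a list of atomic formulae; the head of the list is the last conjunct. -/
def obj : List (V × V) → MEq V
  | [] => 𝟙_ (MEq V)
  | a :: Γ => obj Γ ⊗ atom a.1 a.2

/-- The arrow `r_x`. -/
def unitArrow (x : V) : 𝟙_ (MEq V) ⟶ atom x x := arrow (.r x)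

/-- The arrow `t_{x,y,z}`. -/
def transArrow (x y z : V) : atom x y ⊗ atom y z ⟶ atom x z := arrow (.t x y z)

/-- The arrow `s_{x,y}`. -/
def symmArrow (x y : V) : atom x y ⟶ atom y x := arrow (.s x y)

theorem symmArrow_symmArrow (x y : V) : symmArrow x y ≫ symmArrow y x = 𝟙 _ := sound (.s_s x y)

theorem unitArrow_symmArrow (x : V) : unitArrow x ≫ symmArrow x x = unitArrow x := sound (.r_s x)

theorem whiskerLeft_unitArrow_transArrow (x y : V) :
    atom x y ◁ unitArrow y ≫ transArrow x y y = (ρ_ (atom x y)).hom := sound (.r_t_d x y)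

theorem unitArrow_whiskerRight_transArrow (x y : V) :
    unitArrow y ▷ atom y x ≫ transArrow y y x = (λ_ (atom y x)).hom := sound (.r_t_sig x y)

theorem transArrow_assoc (x y z w : V) :
    transArrow x y z ▷ atom z w ≫ transArrow x z w =
      (α_ _ _ _).hom ≫ atom x y ◁ transArrow y z w ≫ transArrow x y w := by
  rw [← Iso.inv_comp_eq]
  exact (Category.assoc _ _ _).symm.trans (sound (.symm (.t_b x y z w)))

/-! ### Words, and trees built from `t` and `s` -/

/-- A letter is the position of an atomic conjunct, together with the information whether it is
read from right to left. -/
abbrev Letter : Type := ℕ × Bool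

/-- The word read backwards. -/
def flipWord (w : List Letter) : List Letter := w.reverse.map fun l => (l.1, !l.2)

@[simp] theorem flipWord_flipWord (w : List Letter) : flipWord (flipWord w) = w := by
  simp [flipWord, Function.comp_def]

theorem flipWord_append (u v : List Letter) :
    flipWord (u ++ v) = flipWord v ++ flipWord u := by
  simp [flipWord]

/-- Two adjacent factors are multiplied by `t`. -/
def mulArrow {Ξ Δ Γ : List (V × V)} {x y z : V} (f : obj Δ ⟶ obj Γ ⊗ atom x y)
    (g : obj Ξ ⟶ obj Δ ⊗ atom y z) : obj Ξ ⟶ obj Γ ⊗ atom x z :=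
  g ≫ f ▷ atom y z ≫ (α_ (obj Γ) (atom x y) (atom y z)).hom ≫ obj Γ ◁ transArrow x y z

/-- The last factor is inverted by `s`. -/
def invArrow {A : MEq V} {Γ : List (V × V)} {x y : V} (f : A ⟶ obj Γ ⊗ atom x y) :
    A ⟶ obj Γ ⊗ atom y x :=
  f ≫ obj Γ ◁ symmArrow x y

@[simp] theorem invArrow_invArrow {A : MEq V} {Γ : List (V × V)} {x y : V}
    (f : A ⟶ obj Γ ⊗ atom x y) : invArrow (invArrow f) = f := by
  rw [invArrow, invArrow, Category.assoc, ← whiskerLeft_comp, symmArrow_symmArrow,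
    whiskerLeft_id, Category.comp_id]

/-- Associativity of `t` in the context `obj Γ`. Interchange moves `f` past the multiplication of
the two factors to its right, and the pentagon rearranges the brackets. -/
theorem mulArrow_assoc {Ξ Θ Δ Γ : List (V × V)} {x y z w : V} (f : obj Δ ⟶ obj Γ ⊗ atom x y)
    (g : obj Θ ⟶ obj Δ ⊗ atom y z) (h : obj Ξ ⟶ obj Θ ⊗ atom z w) :
    mulArrow (mulArrow f g) h = mulArrow f (mulArrow g h) := by
  simp only [mulArrow, comp_whiskerRight, Category.assoc, whisker_assoc, Iso.inv_hom_id_assoc,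
    whisker_exchange_assoc, whiskerRight_tensor, tensor_whiskerLeft]
  rw [← whiskerLeft_comp, transArrow_assoc]
  simp only [whiskerLeft_comp, pentagon_assoc, Iso.hom_inv_id_assoc]

/-- `f` multiplies the conjuncts of `Ξ` to the right of `Γ` by means of `t` and `s`; they are
multiplied in the order and orientation in which they occur in the word. -/
inductive IsTree : {Ξ Γ : List (V × V)} → {x y : V} → List Letter →
    (obj Ξ ⟶ obj Γ ⊗ atom x y) → Prop
  | pos (Γ : List (V × V)) (x y : V) :
      IsTree (Ξ := (x, y) :: Γ) (Γ := Γ) [(Γ.length, false)] (𝟙 (obj Γ ⊗ atom x y))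
  | neg (Γ : List (V × V)) (x y : V) :
      IsTree (Ξ := (x, y) :: Γ) (Γ := Γ) [(Γ.length, true)]
        (invArrow (𝟙 (obj Γ ⊗ atom x y)))
  | mul {Ξ Δ Γ : List (V × V)} {x y z : V} {u v : List Letter} {f : obj Δ ⟶ obj Γ ⊗ atom x y}
      {g : obj Ξ ⟶ obj Δ ⊗ atom y z} : IsTree u f → IsTree v g →
      IsTree (u ++ v) (mulArrow f g)
  -- The inversion is attached to the product and cannot be repeated, so no `s ∘ s` occurs. It is
  -- not pushed into the factors, because no equation exchanges `s` and `t`.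
  | invMul {Ξ Δ Γ : List (V × V)} {x y z : V} {u v : List Letter}
      {f : obj Δ ⟶ obj Γ ⊗ atom x y} {g : obj Ξ ⟶ obj Δ ⊗ atom y z} :
      IsTree u f → IsTree v g → IsTree (flipWord (u ++ v)) (invArrow (mulArrow f g))

/-! ### The word of a tree determines the tree -/

namespace IsTree

variable {Ξ Γ : List (V × V)} {x y : V} {w : List Letter} {f : obj Ξ ⟶ obj Γ ⊗ atom x y}

/-- Inversion exchanges the constructors `pos` and `neg`, and `mul` and `invMul`, because `s` is an
involution. -/
theorem inv (h : IsTree w f) : IsTree (flipWord w) (invArrow f) := by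
  cases h with
  | pos => exact neg _ _ _
  | neg Γ =>
    exact (congrArg (IsTree _) (invArrow_invArrow (𝟙 (obj Γ ⊗ atom y x)))).mpr (pos _ _ _)
  | mul h1 h2 => exact invMul h1 h2
  | invMul h1 h2 => rw [invArrow_invArrow, flipWord_flipWord]; exact mul h1 h2

theorem ne_nil (h : IsTree w f) : w ≠ [] := by
  induction h with
  | pos => simp
  | neg => simp
  | mul _ _ ih => simp [ih]
  | invMul _ _ ih => simp [flipWord, ih]

theorem suffix (h : IsTree w f) : Γ <:+ Ξ := by
  induction h with
  | pos => exact List.suffix_cons _ _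
  | neg => exact List.suffix_cons _ _
  | mul _ _ ih1 ih2 => exact ih1.trans ih2
  | invMul _ _ ih1 ih2 => exact ih1.trans ih2

theorem length_eq (h : IsTree w f) : Ξ.length = Γ.length + w.length := by
  induction h with
  | pos => simp
  | neg => simp
  | mul _ _ ih1 ih2 => rw [List.length_append]; omega
  | invMul _ _ ih1 ih2 => simp only [flipWord, List.length_map, List.length_reverse,
      List.length_append]; omega

theorem mem_flipWord {w : List Letter} {l : Letter} (h : l ∈ flipWord w) :
    ∃ l' ∈ w, l'.1 = l.1 := by
  simp only [flipWord, List.mem_map, List.mem_reverse] at h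
  obtain ⟨l', h, rfl⟩ := h
  exact ⟨l', h, rfl⟩

/-- A tree consumes the block of conjuncts of `Ξ` beyond `Γ`. Hence in a product all positions in
the left factor lie below those in the right factor. -/
theorem position_mem (h : IsTree w f) : ∀ l ∈ w, Γ.length ≤ l.1 ∧ l.1 < Ξ.length := by
  have aux : ∀ {Ξ Δ Γ : List (V × V)} {u v : List Letter},
      Γ.length ≤ Δ.length → Δ.length ≤ Ξ.length →
      (∀ l ∈ u, Γ.length ≤ l.1 ∧ l.1 < Δ.length) → (∀ l ∈ v, Δ.length ≤ l.1 ∧ l.1 < Ξ.length) →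
      ∀ l ∈ u ++ v, Γ.length ≤ l.1 ∧ l.1 < Ξ.length := by
    intro Ξ Δ Γ u v h1 h2 h3 h4 l hl
    rcases List.mem_append.1 hl with hl | hl
    · have := h3 l hl; omega
    · have := h4 l hl; omega
  induction h with
  | pos => simp
  | neg => simp
  | mul h1 h2 ih1 ih2 =>
    exact aux (by rw [h1.length_eq]; omega) (by rw [h2.length_eq]; omega) ih1 ih2
  | invMul h1 h2 ih1 ih2 =>
    intro l hl
    obtain ⟨l', hl', e⟩ := mem_flipWord hl
    rw [← e]
    exact aux (by rw [h1.length_eq]; omega) (by rw [h2.length_eq]; omega) ih1 ih2 l' hl'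

theorem nodup (h : IsTree w f) : (w.map Prod.fst).Nodup := by
  have aux : ∀ {Ξ Δ Γ : List (V × V)} {x y z : V} {u v : List Letter}
      {f : obj Δ ⟶ obj Γ ⊗ atom x y} {g : obj Ξ ⟶ obj Δ ⊗ atom y z}, IsTree u f → IsTree v g →
      (u.map Prod.fst).Nodup → (v.map Prod.fst).Nodup → ((u ++ v).map Prod.fst).Nodup := by
    intro Ξ Δ Γ x y z u v f g h1 h2 h3 h4
    rw [List.map_append, List.nodup_append]
    refine ⟨h3, h4, fun a ha b hb => ?_⟩
    obtain ⟨l, hl, rfl⟩ := List.mem_map.1 ha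
    obtain ⟨l', hl', rfl⟩ := List.mem_map.1 hb
    have := h1.position_mem l hl
    have := h2.position_mem l' hl'
    omega
  induction h with
  | pos => simp
  | neg => simp
  | mul h1 h2 ih1 ih2 => exact aux h1 h2 ih1 ih2
  | invMul h1 h2 ih1 ih2 =>
    have e : ∀ w : List Letter, (flipWord w).map Prod.fst = (w.map Prod.fst).reverse := by
      intro w; simp [flipWord, Function.comp_def]
    rw [e, List.nodup_reverse]
    exact aux h1 h2 ih1 ih2

/-- A factorization of the word into a part with smaller and a part with larger positions comes
from a factorization of the arrow. -/
theorem exists_mulArrow (h : IsTree w f) : ∀ {u v : List Letter}, w = u ++ v → u ≠ [] → v ≠ [] →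
    (∀ l ∈ u, ∀ l' ∈ v, l.1 < l'.1) →
    ∃ (Δ : List (V × V)) (z : V) (f₁ : obj Δ ⟶ obj Γ ⊗ atom x z)
      (f₂ : obj Ξ ⟶ obj Δ ⊗ atom z y), IsTree u f₁ ∧ IsTree v f₂ ∧ f = mulArrow f₁ f₂ := by
  induction h with
  | pos =>
    intro u v e hu hv
    have := congrArg List.length e
    have := List.length_pos_of_ne_nil hu
    have := List.length_pos_of_ne_nil hv
    simp at *
    omega
  | neg =>
    intro u v e hu hv
    have := congrArg List.length e
    have := List.length_pos_of_ne_nil hu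
    have := List.length_pos_of_ne_nil hv
    simp at *
    omega
  | @mul Ξ Δ Γ x y z u' v' f g h1 h2 ih1 ih2 =>
    intro u v e hu hv huv
    -- The given cut falls inside the right factor or inside the left one, with `c` between the two
    -- cuts. If `c` is empty, the cuts coincide. Otherwise that factor is split by induction and the
    -- product is rebracketed.
    rcases List.append_eq_append_iff.1 e with ⟨c, rfl, rfl⟩ | ⟨c, rfl, rfl⟩
    · by_cases hc : c = []
      · subst hc
        exact ⟨Δ, y, f, g, by simpa using h1, by simpa using h2, rfl⟩
      · obtain ⟨Θ, a, g₁, g₂, h3, h4, rfl⟩ := ih2 rfl hc hv fun l hl l' hl' =>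
          huv l (List.mem_append_right _ hl) l' hl'
        exact ⟨Θ, a, mulArrow f g₁, g₂, mul h1 h3, h4, (mulArrow_assoc _ _ _).symm⟩
    · by_cases hc : c = []
      · subst hc
        exact ⟨Δ, y, f, g, by simpa using h1, by simpa using h2, rfl⟩
      · obtain ⟨Θ, a, g₁, g₂, h3, h4, rfl⟩ := ih1 rfl hu hc fun l hl l' hl' =>
          huv l hl l' (List.mem_append_left _ hl')
        exact ⟨Θ, a, g₁, mulArrow g₂ g, h3, mul h4 h2, mulArrow_assoc _ _ _⟩
  | @invMul Ξ Δ Γ x y z u' v' f g h1 h2 _ _ =>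
    intro u v e hu hv huv
    -- The inverted word begins with a letter of `v'`, at a position at least `Δ.length`, and ends
    -- with a letter of `u'`, at a position below `Δ.length`. The required cut demands the opposite
    -- order.
    exfalso
    rw [flipWord_append] at e
    have hu' : flipWord u' ≠ [] := h1.inv.ne_nil
    have hv' : flipWord v' ≠ [] := h2.inv.ne_nil
    have e1 : (flipWord v').head hv' = u.head hu := by
      have := congrArg List.head? e
      rwa [List.head?_append_of_ne_nil _ hv', List.head?_append_of_ne_nil _ hu,
        List.head?_eq_some_head hv', List.head?_eq_some_head hu, Option.some_inj] at this
    have e2 : (flipWord u').getLast hu' = v.getLast hv := by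
      have := congrArg List.getLast? e
      rwa [List.getLast?_append_of_ne_nil _ hu', List.getLast?_append_of_ne_nil _ hv,
        List.getLast?_eq_some_getLast hu', List.getLast?_eq_some_getLast hv,
        Option.some_inj] at this
    have := h2.inv.position_mem _ (List.head_mem hv')
    have := h1.inv.position_mem _ (List.getLast_mem hu')
    have := huv _ (List.head_mem hu) _ (List.getLast_mem hv)
    rw [← e1, ← e2] at this
    omega

/-- `x` and `y` are the variables of the conjunct of `Ξ` that the letter designates, in the order in
which they are read. -/
def _root_.MEq.Reads (Ξ : List (V × V)) (l : Letter) (x y : V) : Prop :=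
  ∃ Θ, (if l.2 then (y, x) else (x, y)) :: Θ <:+ Ξ ∧ Θ.length = l.1

theorem _root_.MEq.Reads.unique {l : Letter} {x' y' : V} (h : Reads Ξ l x y)
    (h' : Reads Ξ l x' y') : x = x' ∧ y = y' := by
  obtain ⟨Θ, h1, h2⟩ := h
  obtain ⟨Θ', h3, h4⟩ := h'
  have := (List.suffix_of_suffix_length_le h1 h3 (by simp [h2, h4])).eq_of_length
    (by simp [h2, h4])
  have := (List.cons.inj this).1
  split at this <;> simp_all

theorem _root_.MEq.Reads.mono {l : Letter} (h : Reads Γ l x y) (h' : Γ <:+ Ξ) :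
    Reads Ξ l x y := by
  obtain ⟨Θ, h1, h2⟩ := h
  exact ⟨Θ, h1.trans h', h2⟩

theorem _root_.MEq.Reads.flip {l : Letter} (h : Reads Ξ l x y) : Reads Ξ (l.1, !l.2) y x := by
  obtain ⟨Θ, h1, h2⟩ := h
  refine ⟨Θ, ?_, h2⟩
  cases hl : l.2 <;> simp_all

/-- The outer variables of the product are read at the two ends of the word, and inversion exchanges
the ends. This recovers the target atom from the word. -/
theorem reads_ends (h : IsTree w f) :
    (∃ l ∈ w.head?, ∃ z, Reads Ξ l x z) ∧ ∃ l ∈ w.getLast?, ∃ z, Reads Ξ l z y := by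
  have aux : ∀ {Ξ Δ Γ : List (V × V)} {x y z : V} {u v : List Letter}
      {f : obj Δ ⟶ obj Γ ⊗ atom x y} {g : obj Ξ ⟶ obj Δ ⊗ atom y z}, IsTree u f → IsTree v g →
      ((∃ l ∈ u.head?, ∃ a, Reads Δ l x a) ∧ ∃ l ∈ u.getLast?, ∃ a, Reads Δ l a y) →
      ((∃ l ∈ v.head?, ∃ a, Reads Ξ l y a) ∧ ∃ l ∈ v.getLast?, ∃ a, Reads Ξ l a z) →
      (∃ l ∈ (u ++ v).head?, ∃ a, Reads Ξ l x a) ∧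
        ∃ l ∈ (u ++ v).getLast?, ∃ a, Reads Ξ l a z := by
    rintro Ξ Δ Γ x y z u v f g h1 h2 ⟨⟨l, h3, a, h4⟩, -⟩ ⟨-, h5⟩
    rw [List.head?_append_of_ne_nil _ h1.ne_nil, List.getLast?_append_of_ne_nil _ h2.ne_nil]
    exact ⟨⟨l, h3, a, h4.mono h2.suffix⟩, h5⟩
  induction h with
  | pos Γ x y =>
    exact ⟨⟨_, rfl, y, Γ, List.suffix_refl _, rfl⟩, ⟨_, rfl, x, Γ, List.suffix_refl _, rfl⟩⟩
  | neg Γ x y =>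
    exact ⟨⟨_, rfl, x, Γ, List.suffix_refl _, rfl⟩, ⟨_, rfl, y, Γ, List.suffix_refl _, rfl⟩⟩
  | mul h1 h2 ih1 ih2 => exact aux h1 h2 ih1 ih2
  | invMul h1 h2 ih1 ih2 =>
    obtain ⟨⟨l, h3, a, h4⟩, l', h5, a', h6⟩ := aux h1 h2 ih1 ih2
    rw [flipWord, List.head?_map, List.getLast?_map, List.head?_reverse, List.getLast?_reverse,
      h5, h3]
    exact ⟨⟨_, rfl, _, h6.flip⟩, _, rfl, _, h4.flip⟩

/-- The remaining context is a suffix of `Ξ` whose length is fixed by the length of the word, and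
the variables are read at the ends of the word. This identifies the intermediate objects of two
factorizations before their arrows are compared. -/
theorem target_unique (h : IsTree w f) {Γ' : List (V × V)} {x' y' : V}
    {g : obj Ξ ⟶ obj Γ' ⊗ atom x' y'} (h' : IsTree w g) : Γ = Γ' ∧ x = x' ∧ y = y' := by
  obtain ⟨⟨l, h1, a, h2⟩, l', h3, a', h4⟩ := h.reads_ends
  obtain ⟨⟨m, h5, b, h6⟩, m', h7, b', h8⟩ := h'.reads_ends
  obtain rfl := Option.mem_unique h1 h5
  obtain rfl := Option.mem_unique h3 h7
  have e1 := h.length_eq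
  have e2 := h'.length_eq
  exact ⟨(List.suffix_of_suffix_length_le h.suffix h'.suffix (by omega)).eq_of_length (by omega),
    (h2.unique h6).1, (h4.unique h8).2⟩

/-- The word determines the arrow. -/
theorem unique (h : IsTree w f) : ∀ {g : obj Ξ ⟶ obj Γ ⊗ atom x y}, IsTree w g → f = g := by
  have aux : ∀ {Ξ Δ Γ : List (V × V)} {x y z : V} {u v : List Letter}
      {f : obj Δ ⟶ obj Γ ⊗ atom x y} {g : obj Ξ ⟶ obj Δ ⊗ atom y z}, IsTree u f → IsTree v g →
      (∀ {f' : obj Δ ⟶ obj Γ ⊗ atom x y}, IsTree u f' → f = f') →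
      (∀ {g' : obj Ξ ⟶ obj Δ ⊗ atom y z}, IsTree v g' → g = g') →
      ∀ {k : obj Ξ ⟶ obj Γ ⊗ atom x z}, IsTree (u ++ v) k → mulArrow f g = k := by
    intro Ξ Δ Γ x y z u v f g h1 h2 ih1 ih2 k hk
    -- The other arrow is cut at the same place of the word. The right factors start from the same
    -- `Ξ`, so they fix the middle list and the middle variable, and induction applies to both
    -- factors.
    obtain ⟨Δ', y', f', g', h3, h4, rfl⟩ := hk.exists_mulArrow rfl h1.ne_nil h2.ne_nil
      fun l hl l' hl' => (h1.position_mem l hl).2.trans_le (h2.position_mem l' hl').1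
    obtain ⟨rfl, rfl, -⟩ := h2.target_unique h4
    rw [ih1 h3, ih2 h4]
  -- A product has two nonempty factors, hence at least two letters.
  have atomic : ∀ {Γ : List (V × V)} {x y : V} {g : obj ((x, y) :: Γ) ⟶ obj Γ ⊗ atom x y},
      IsTree [(Γ.length, false)] g → 𝟙 (obj Γ ⊗ atom x y) = g := by
    intro Γ x y g hg
    generalize hw : [(Γ.length, false)] = w at hg
    cases hg with
    | pos => rfl
    | neg => simp at hw
    | mul h1 h2 =>
      have := congrArg List.length hw
      have := List.length_pos_of_ne_nil h1.ne_nil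
      have := List.length_pos_of_ne_nil h2.ne_nil
      simp at *; omega
    | invMul h1 h2 =>
      have := congrArg List.length hw
      have := List.length_pos_of_ne_nil h1.ne_nil
      have := List.length_pos_of_ne_nil h2.ne_nil
      simp [flipWord] at *; omega
  induction h with
  | pos Γ x y => exact atomic
  | neg Γ x y =>
    intro g hg
    rw [atomic (by simpa [flipWord] using hg.inv), invArrow_invArrow]
  | mul h1 h2 ih1 ih2 => exact aux h1 h2 ih1 ih2
  | invMul h1 h2 ih1 ih2 =>
    intro k hk
    -- Inverting both sides reduces this case to the uninverted product.
    have := hk.inv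
    rw [flipWord_flipWord] at this
    rw [aux h1 h2 ih1 ih2 this, invArrow_invArrow]

end IsTree
end MEq

/-! ### Objects acting on a context from the right -/

section Monoidal

variable {C : Type*} [Category C] [MonoidalCategory C] {W X Y Z Y' Z' A B A' B' D : C}

/-- Two successive actions by `A` and `B` as an action by `A ⊗ B`. -/
def actTensor (p : X ⊗ A ≅ Y) (q : Y ⊗ B ≅ Z) : X ⊗ (A ⊗ B) ≅ Z :=
  (α_ X A B).symm ≪≫ whiskerRightIso p B ≪≫ q

theorem actTensor_whiskerRight (p : X ⊗ A ≅ Y) (q : Y ⊗ B ≅ Z) (p' : W ⊗ A ≅ Y')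
    (q' : Y' ⊗ B ≅ Z') (k : X ⟶ W) :
    q.inv ≫ (p.inv ≫ k ▷ A ≫ p'.hom) ▷ B ≫ q'.hom =
      (actTensor p q).inv ≫ k ▷ (A ⊗ B) ≫ (actTensor p' q').hom := by
  simp [actTensor]

/-- The associator intertwines the two iterated actions. The two lemmas on unitors say the same of
`δ` and `σ`, so that by `act_hom` and `act_inv` all structural arrows flatten to identities. -/
theorem actTensor_associator (p : X ⊗ A ≅ Y) (q : Y ⊗ B ≅ Z) (r : Z ⊗ D ≅ W) :
    X ◁ (α_ A B D).hom ≫ (actTensor p (actTensor q r)).hom =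
      (actTensor (actTensor p q) r).hom := by
  simp [actTensor]

theorem actTensor_rightUnitor (p : X ⊗ A ≅ Y) :
    X ◁ (ρ_ A).hom ≫ p.hom = (actTensor p (ρ_ Y)).hom := by
  simp [actTensor]

theorem actTensor_leftUnitor (p : X ⊗ A ≅ Y) :
    X ◁ (λ_ A).hom ≫ p.hom = (actTensor (ρ_ X) p).hom := by
  simp [actTensor]

/-- Bifunctoriality in flattened form: `g` acts first, in the context already extended by `A`, and
then `f` acts with `B'` standing to its right. -/
theorem actTensor_tensorHom (p : X ⊗ A ≅ Y) (q : Y ⊗ B ≅ Z) (p' : X ⊗ A' ≅ Y')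
    (q' : Y' ⊗ B' ≅ Z') (q'' : Y ⊗ B' ≅ W) (f : A ⟶ A') (g : B ⟶ B') :
    (q.inv ≫ Y ◁ g ≫ q''.hom) ≫ q''.inv ≫ (p.inv ≫ X ◁ f ≫ p'.hom) ▷ B' ≫ q'.hom =
      (actTensor p q).inv ≫ X ◁ (f ⊗ₘ g) ≫ (actTensor p' q').hom := by
  simp only [Category.assoc, Iso.hom_inv_id_assoc, comp_whiskerRight, whisker_exchange_assoc]
  rw [← whisker_exchange_assoc]
  simp [actTensor, MonoidalCategory.tensorHom_def]

theorem act_hom (p : X ⊗ A ≅ Y) (q : X ⊗ B ≅ Y) (e : A ≅ B) (h : X ◁ e.hom ≫ q.hom = p.hom) :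
    𝟙 Y = p.inv ≫ X ◁ e.hom ≫ q.hom := by
  simp [h]

theorem act_inv (p : X ⊗ A ≅ Y) (q : X ⊗ B ≅ Y) (e : A ≅ B) (h : X ◁ e.hom ≫ q.hom = p.hom) :
    𝟙 Y = q.inv ≫ X ◁ e.inv ≫ p.hom := by
  simp [← h]

end Monoidal

/-! ### Forests and their closure under the generating arrows -/

namespace MEq

variable {V : Type u}

/-- A sequence of trees, and of arrows `r`, one for each conjunct of the target. -/
inductive IsForest : {Ξ Δ : List (V × V)} → List (List Letter) → (obj Ξ ⟶ obj Δ) → Prop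
  | nil : IsForest [] (𝟙 (obj []))
  | cons {Ξ Γ Δ : List (V × V)} {x y : V} {w : List Letter} {W : List (List Letter)}
      {f : obj Ξ ⟶ obj Γ ⊗ atom x y} {h : obj Γ ⟶ obj Δ} : IsTree w f → IsForest W h →
      IsForest (Δ := (x, y) :: Δ) (w :: W) (f ≫ h ▷ atom x y)
  | unit {Ξ Δ : List (V × V)} (x : V) {W : List (List Letter)} {h : obj Ξ ⟶ obj Δ} :
      IsForest W h →
      IsForest (Δ := (x, x) :: Δ) ([] :: W) (h ≫ (ρ_ (obj Δ)).inv ≫ obj Δ ◁ unitArrow x)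

/-- The words determine the arrow. -/
theorem IsForest.unique {Ξ Δ : List (V × V)} {W : List (List Letter)} {f : obj Ξ ⟶ obj Δ}
    (h : IsForest W f) : ∀ {g : obj Ξ ⟶ obj Δ}, IsForest W g → f = g := by
  induction h with
  | nil =>
    intro g hg
    cases hg
    rfl
  | cons h1 h2 ih =>
    intro g hg
    cases hg with
    | cons h3 h4 =>
      -- The last word fixes the list of conjuncts that is left over for the rest of the forest.
      obtain ⟨rfl, -, -⟩ := h1.target_unique h3
      rw [h1.unique h3, ih h4]
    | unit => exact (h1.ne_nil rfl).elim
  | unit x h ih =>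
    intro g hg
    cases hg with
    | cons h3 h4 => exact (h3.ne_nil rfl).elim
    | unit _ h4 => rw [ih h4]

theorem IsForest.congr {Ξ Δ : List (V × V)} {W : List (List Letter)} {f g : obj Ξ ⟶ obj Δ}
    (h : IsForest W f) (e : f = g) : IsForest W g := e ▸ h

theorem exists_isForest_id : ∀ Γ : List (V × V), ∃ W, IsForest W (𝟙 (obj Γ))
  | [] => ⟨_, .nil⟩
  | (x, y) :: Γ => by
    obtain ⟨W, hW⟩ := exists_isForest_id Γ
    have e : 𝟙 (obj Γ ⊗ atom x y) ≫ 𝟙 (obj Γ) ▷ atom x y = 𝟙 (obj Γ ⊗ atom x y) := by simp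
    exact ⟨_, (IsForest.cons (IsTree.pos Γ x y) hW).congr e⟩

/-- Postcomposition with `k` sends forests to forests. -/
def PreservesForests {Δ Δ' : List (V × V)} (k : obj Δ ⟶ obj Δ') : Prop :=
  ∀ ⦃Ξ : List (V × V)⦄ ⦃W : List (List Letter)⦄ ⦃h : obj Ξ ⟶ obj Δ⦄, IsForest W h →
    ∃ W', IsForest W' (h ≫ k)

theorem PreservesForests.congr {Δ Δ' : List (V × V)} {k k' : obj Δ ⟶ obj Δ'}
    (hk : PreservesForests k) (e : k = k') : PreservesForests k' := e ▸ hk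

theorem preservesForests_id (Δ : List (V × V)) : PreservesForests (𝟙 (obj Δ)) := fun Ξ W h hW =>
  ⟨W, by rwa [Category.comp_id]⟩

theorem PreservesForests.comp {Δ Δ' Δ'' : List (V × V)} {k : obj Δ ⟶ obj Δ'}
    {k' : obj Δ' ⟶ obj Δ''} (hk : PreservesForests k) (hk' : PreservesForests k') :
    PreservesForests (k ≫ k') := fun Ξ W h hW => by
  obtain ⟨W', hW'⟩ := hk hW
  rw [← Category.assoc]
  exact hk' hW'

/-- The tree or the `r` that produces the last conjunct is untouched, and `k` acts on the rest of
the forest. -/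
theorem PreservesForests.whiskerRight_atom {Δ Δ' : List (V × V)} {k : obj Δ ⟶ obj Δ'}
    (hk : PreservesForests k) (x y : V) :
    PreservesForests (Δ := (x, y) :: Δ) (Δ' := (x, y) :: Δ') (k ▷ atom x y) := fun Ξ W h hW => by
  cases hW with
  | @cons _ Γ _ _ _ w W f h h1 h2 =>
    obtain ⟨W', hW'⟩ := hk h2
    have e : f ≫ (h ≫ k) ▷ atom x y = (f ≫ h ▷ atom x y) ≫ k ▷ atom x y := by simp
    exact ⟨w :: W', (IsForest.cons h1 hW').congr e⟩
  | @unit _ _ _ W h h1 =>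
    obtain ⟨W', hW'⟩ := hk h1
    have e : (h ≫ k) ≫ (ρ_ (obj Δ')).inv ≫ obj Δ' ◁ unitArrow x =
        (h ≫ (ρ_ (obj Δ)).inv ≫ obj Δ ◁ unitArrow x) ≫ k ▷ atom x x := by
      simp [whisker_exchange]
    exact ⟨[] :: W', (hW'.unit x).congr e⟩

theorem preservesForests_unitArrow (Δ : List (V × V)) (x : V) :
    PreservesForests (Δ' := (x, x) :: Δ) ((ρ_ (obj Δ)).inv ≫ obj Δ ◁ unitArrow x) :=
  fun _ _ _ hW => ⟨_, hW.unit x⟩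

/-- A tree is inverted by `IsTree.inv`, and an arrow `r` absorbs `s` by the equation `(rs)`. -/
theorem preservesForests_symmArrow (Δ : List (V × V)) (x y : V) :
    PreservesForests (Δ := (x, y) :: Δ) (Δ' := (y, x) :: Δ) (obj Δ ◁ symmArrow x y) :=
  fun Ξ W h hW => by
  cases hW with
  | @cons _ Γ _ _ _ w W f h h1 h2 =>
    have e : invArrow f ≫ h ▷ atom y x = (f ≫ h ▷ atom x y) ≫ obj Δ ◁ symmArrow x y := by
      simp [invArrow, whisker_exchange]
    exact ⟨_, (IsForest.cons h1.inv h2).congr e⟩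
  | @unit _ _ _ W h h1 =>
    have e : h ≫ (ρ_ (obj Δ)).inv ≫ obj Δ ◁ unitArrow x =
        (h ≫ (ρ_ (obj Δ)).inv ≫ obj Δ ◁ unitArrow x) ≫ obj Δ ◁ symmArrow x x := by
      simp [← whiskerLeft_comp, unitArrow_symmArrow]
    exact ⟨_, (h1.unit x).congr e⟩

/-- Two trees are multiplied into one. If one of the two factors is an `r`, the corresponding unit
law leaves the other factor as it is. -/
theorem preservesForests_transArrow (Δ : List (V × V)) (x y z : V) :
    PreservesForests (Δ := (y, z) :: (x, y) :: Δ) (Δ' := (x, z) :: Δ)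
      ((α_ (obj Δ) (atom x y) (atom y z)).hom ≫ obj Δ ◁ transArrow x y z) :=
  fun Ξ W h hW => by
  cases hW with
  | @cons _ Γ _ _ _ w W f h h1 h2 =>
    cases h2 with
    | @cons _ Γ' _ _ _ w' W f' h h3 h4 =>
      have e : mulArrow f' f ≫ h ▷ atom x z = (f ≫ (f' ≫ h ▷ atom x y) ▷ atom y z) ≫
          (α_ (obj Δ) (atom x y) (atom y z)).hom ≫ obj Δ ◁ transArrow x y z := by
        simp [mulArrow, whisker_exchange]
      exact ⟨_, (IsForest.cons (h3.mul h1) h4).congr e⟩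
    | @unit _ _ _ W h h3 =>
      have e : f ≫ h ▷ atom x z =
          (f ≫ (h ≫ (ρ_ (obj Δ)).inv ≫ obj Δ ◁ unitArrow x) ▷ atom x z) ≫
          (α_ (obj Δ) (atom x x) (atom x z)).hom ≫ obj Δ ◁ transArrow x x z := by
        simp [← whiskerLeft_comp, unitArrow_whiskerRight_transArrow]
      exact ⟨_, (IsForest.cons h1 h3).congr e⟩
  | @unit _ _ _ W h h1 =>
    have e : (ρ_ (obj Δ ⊗ atom x y)).inv ≫ (obj Δ ⊗ atom x y) ◁ unitArrow y ≫
          (α_ (obj Δ) (atom x y) (atom y y)).hom ≫ obj Δ ◁ transArrow x y y = 𝟙 _ := by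
      simp [← whiskerLeft_comp, whiskerLeft_unitArrow_transArrow]
    have e' : h ≫ 𝟙 (obj ((x, y) :: Δ)) = (h ≫ _) ≫ _ :=
      (congrArg (h ≫ ·) (e.symm.trans (Category.assoc _ _ _).symm)).trans
        (Category.assoc _ _ _).symm
    exact ⟨W, h1.congr ((Category.comp_id h).symm.trans e')⟩

/-! ### Flattening of formulae and arrow terms -/

/-- The atomic conjuncts of a formula are added to a list. -/
def flat : Formula V → List (V × V) → List (V × V)
  | .eqv x y, Γ => (x, y) :: Γ
  | .top, Γ => Γ
  | .conj A B, Γ => flat B (flat A Γ)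

/-- A formula as an object of `M_≡`. -/
def ofFormula (A : Formula V) : MEq V := A

/-- A formula is isomorphic to the conjunction of its atomic conjuncts. -/
def flatIso : (A : Formula V) → (Γ : List (V × V)) → (obj Γ ⊗ ofFormula A ≅ obj (flat A Γ))
  | .eqv x y, Γ => Iso.refl (obj Γ ⊗ atom x y)
  | .top, Γ => ρ_ (obj Γ)
  | .conj A B, Γ => actTensor (flatIso A Γ) (flatIso B (flat A Γ))

theorem PreservesForests.whiskerRight {Δ Δ' : List (V × V)} {k : obj Δ ⟶ obj Δ'}
    (hk : PreservesForests k) (A : Formula V) :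
    PreservesForests ((flatIso A Δ).inv ≫ k ▷ ofFormula A ≫ (flatIso A Δ').hom) := by
  induction A generalizing Δ Δ' with
  | eqv x y =>
    have e : k ▷ atom x y = (Iso.refl (obj Δ ⊗ atom x y)).inv ≫ k ▷ atom x y ≫
      (Iso.refl (obj Δ' ⊗ atom x y)).hom := by simp
    exact (hk.whiskerRight_atom x y).congr e
  | top =>
    have e : k = (ρ_ (obj Δ)).inv ≫ k ▷ 𝟙_ (MEq V) ≫ (ρ_ (obj Δ')).hom := by simp
    exact hk.congr e
  | conj A B ihA ihB => exact (ihB (ihA hk)).congr (actTensor_whiskerRight _ _ _ _ _)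

/-- An arrow between formulae as an arrow between the conjunctions of their atomic conjuncts. -/
def flatArrow {A B : Formula V} (f : ofFormula A ⟶ ofFormula B) (Γ : List (V × V)) :
    obj (flat A Γ) ⟶ obj (flat B Γ) :=
  (flatIso A Γ).inv ≫ obj Γ ◁ f ≫ (flatIso B Γ).hom

/-- Both bracketings of a conjunction, with or without `⊤`, have the same list by definition, so
structural terms act as identities. The context `Γ` varies in the induction because the right factor
of a conjunction acts to the right of the left factor. -/
theorem preservesForests_flatArrow {A B : Formula V} (f : Term A B) (Γ : List (V × V)) :
    PreservesForests (flatArrow (arrow f : ofFormula A ⟶ ofFormula B) Γ) := by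
  induction f generalizing Γ with
  | id A => exact (preservesForests_id _).congr (act_hom _ _ (Iso.refl _) (by simp))
  | bTo A B C =>
    exact (preservesForests_id _).congr (act_inv _ _ (α_ (ofFormula A) (ofFormula B) (ofFormula C))
      (actTensor_associator _ _ _))
  | bFrom A B C =>
    exact (preservesForests_id _).congr (act_hom _ _ (α_ (ofFormula A) (ofFormula B) (ofFormula C))
      (actTensor_associator _ _ _))
  | dTo A =>
    exact (preservesForests_id _).congr (act_hom _ _ (ρ_ (ofFormula A)) (actTensor_rightUnitor _))
  | dFrom A =>
    exact (preservesForests_id _).congr (act_inv _ _ (ρ_ (ofFormula A)) (actTensor_rightUnitor _))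
  | sigTo A =>
    exact (preservesForests_id _).congr (act_hom _ _ (λ_ (ofFormula A)) (actTensor_leftUnitor _))
  | sigFrom A =>
    exact (preservesForests_id _).congr (act_inv _ _ (λ_ (ofFormula A)) (actTensor_leftUnitor _))
  | r x =>
    have e : (ρ_ (obj Γ)).inv ≫ obj Γ ◁ unitArrow x = (ρ_ (obj Γ)).inv ≫ obj Γ ◁ unitArrow x ≫
      (Iso.refl (obj Γ ⊗ atom x x)).hom := by simp
    exact (preservesForests_unitArrow Γ x).congr e
  | t x y z =>
    have e : (α_ (obj Γ) (atom x y) (atom y z)).hom ≫ obj Γ ◁ transArrow x y z =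
        (actTensor (Iso.refl (obj Γ ⊗ atom x y)) (Iso.refl (_ ⊗ atom y z))).inv ≫
          obj Γ ◁ transArrow x y z ≫ (Iso.refl (obj Γ ⊗ atom x z)).hom := by simp [actTensor]
    exact (preservesForests_transArrow Γ x y z).congr e
  | s x y =>
    have e : obj Γ ◁ symmArrow x y = (Iso.refl (obj Γ ⊗ atom x y)).inv ≫ obj Γ ◁ symmArrow x y ≫
      (Iso.refl (obj Γ ⊗ atom y x)).hom := by simp
    exact (preservesForests_symmArrow Γ x y).congr e
  | @wedge A B C D f g ihf ihg =>
    exact ((ihg (flat A Γ)).comp ((ihf Γ).whiskerRight D)).congr (actTensor_tensorHom _ _ _ _ _ _ _)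
  | @comp A B C g f ihg ihf =>
    have e : flatArrow (arrow f : ofFormula A ⟶ ofFormula B) Γ ≫
        flatArrow (arrow g : ofFormula B ⟶ ofFormula C) Γ =
        flatArrow ((arrow f : ofFormula A ⟶ ofFormula B) ≫ (arrow g : ofFormula B ⟶ ofFormula C))
          Γ := by
      simp [flatArrow]
    exact ((ihf Γ).comp (ihg Γ)).congr e

/-- The identity is a forest of one-letter trees, and postcomposition with the flattened arrow keeps
it a forest. -/
theorem exists_isForest_flatArrow {A B : Formula V} (f : ofFormula A ⟶ ofFormula B) :
    ∃ W, IsForest W (flatArrow f []) := by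
  obtain ⟨W, hW⟩ := exists_isForest_id (flat A ([] : List (V × V)))
  obtain ⟨f⟩ := f
  obtain ⟨W', hW'⟩ := preservesForests_flatArrow f [] hW
  exact ⟨W', hW'.congr (Category.id_comp _)⟩

theorem flatArrow_injective {A B : Formula V} {f g : ofFormula A ⟶ ofFormula B}
    (h : flatArrow f [] = flatArrow g []) : f = g := by
  rw [flatArrow, flatArrow, cancel_epi] at h
  have h' : 𝟙_ (MEq V) ◁ f = 𝟙_ (MEq V) ◁ g := (Iso.cancel_iso_hom_right _ _ (flatIso B [])).1 h
  simpa using h'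

end MEq

/-! ### Joined points of a diagram, detected by labellings -/

namespace BrHom

variable {m n k m' n' : ℕ}

/-- The labellings `ρ` and `σ` of the source and the target points agree on joined points. -/
def Respects (R : BrHom m n) (ρ σ : ℕ → Prop) : Prop := R.Lab (fun i => ρ i) (fun i => σ i)

theorem respects_comp {R : BrHom m n} {S : BrHom n k} {ρ σ : ℕ → Prop} :
    (R.comp S).Respects ρ σ ↔ ∃ τ, R.Respects ρ τ ∧ S.Respects τ σ := by
  rw [Respects, lab_comp]
  constructor
  · rintro ⟨ψ, h1, h2⟩
    -- The labelling of the middle points is extended by `False` beyond `n`; labels out of range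
    -- play no role.
    refine ⟨fun i => ∃ h : i < n, ψ ⟨i, h⟩, ?_⟩
    have e : (fun i : Fin n => ∃ h : (i : ℕ) < n, ψ ⟨i, h⟩) = ψ := by
      funext i
      exact propext ⟨fun ⟨_, h⟩ => h, fun h => ⟨i.2, h⟩⟩
    rw [Respects, Respects, e]
    exact ⟨h1, h2⟩
  · rintro ⟨τ, h1, h2⟩
    exact ⟨_, h1, h2⟩

theorem respects_tensor {R : BrHom m n} {S : BrHom m' n'} {ρ σ : ℕ → Prop} :
    (R.tensor S).Respects ρ σ ↔
      R.Respects ρ σ ∧ S.Respects (fun i => ρ (m + i)) (fun i => σ (n + i)) :=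
  lab_tensor _ _ _ _

theorem respects_lines {h : m = n} {ρ σ : ℕ → Prop} :
    (lines h).Respects ρ σ ↔ ∀ i < m, ρ i = σ i := by
  rw [Respects, lab_lines, funext_iff, Fin.forall_iff]
  rfl

theorem respects_cap {ρ σ : ℕ → Prop} : cap.Respects ρ σ ↔ σ 0 = σ 1 := labels_cap _ _

theorem respects_cup {ρ σ : ℕ → Prop} :
    cup.Respects ρ σ ↔ ρ 1 = ρ 2 ∧ ρ 0 = σ 0 ∧ ρ 3 = σ 1 := labels_cup _ _

theorem respects_cross {ρ σ : ℕ → Prop} :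
    cross.Respects ρ σ ↔ ρ 0 = σ 1 ∧ ρ 1 = σ 0 := labels_cross _ _

/-- `p` and `q` have the same label in all labellings that agree on joined points. -/
def Joined (R : BrHom m n) (p q : ℕ ⊕ ℕ) : Prop :=
  ∀ ρ σ, R.Respects ρ σ → Sum.elim ρ σ p = Sum.elim ρ σ q

/-- Test with the indicator of the class of `p`, which is constant on lines. A `p` out of range is
separated from all other points by its own indicator, since no line meets it. -/
theorem Joined.rel {R : BrHom m n} {p q : ℕ ⊕ ℕ} (h : R.Joined p q) (hpq : q ≠ p) :
    ∃ p' q', Sum.map Fin.val Fin.val p' = p ∧ Sum.map Fin.val Fin.val q' = q ∧ R.rel p' q' := by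
  by_cases hp : ∃ p' : Fin m ⊕ Fin n, Sum.map Fin.val Fin.val p' = p
  · obtain ⟨p', rfl⟩ := hp
    let L : ℕ ⊕ ℕ → Prop := fun x => ∃ q', Sum.map Fin.val Fin.val q' = x ∧ R.rel p' q'
    have hL : ∀ x, Sum.elim (fun i => L (.inl i)) (fun i => L (.inr i)) x = L x := by
      rintro (_ | _) <;> rfl
    have hinj : Function.Injective (Sum.map Fin.val Fin.val : Fin m ⊕ Fin n → ℕ ⊕ ℕ) :=
      Fin.val_injective.sumMap Fin.val_injective
    have hL' : ∀ x : Fin m ⊕ Fin n, Sum.elim (fun i => L (.inl (Fin.val i)))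
        (fun i => L (.inr (Fin.val i))) x = R.rel p' x := by
      intro x
      have : L (Sum.map Fin.val Fin.val x) = R.rel p' x :=
        propext ⟨fun ⟨q', h1, h2⟩ => hinj h1 ▸ h2, fun h => ⟨x, rfl, h⟩⟩
      rw [← this]
      rcases x with _ | _ <;> rfl
    have := h (fun i => L (.inl i)) (fun i => L (.inr i)) fun x y hxy => by
      rw [hL', hL']
      exact propext ⟨fun h => R.rel.trans h hxy, fun h => R.rel.trans h (R.rel.symm hxy)⟩
    rw [hL, hL] at this
    obtain ⟨q', h1, h2⟩ := this.mp ⟨p', rfl, R.rel.refl _⟩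
    exact ⟨p', q', rfl, h1, h2⟩
  · exfalso
    have hL : ∀ x : ℕ ⊕ ℕ, Sum.elim (fun i => p = .inl i) (fun i => p = .inr i) x = (p = x) := by
      rintro (_ | _) <;> rfl
    have := h (fun i => p = .inl i) (fun i => p = .inr i) fun x y _ => by
      have aux : ∀ x : Fin m ⊕ Fin n, ¬ Sum.elim (fun i => p = .inl (Fin.val i))
          (fun i => p = .inr (Fin.val i)) x := by
        rintro (i | i) hi
        · exact hp ⟨.inl i, hi.symm⟩
        · exact hp ⟨.inr i, hi.symm⟩
      exact propext ⟨fun h => (aux x h).elim, fun h => (aux y h).elim⟩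
    rw [hL, hL] at this
    exact hpq (this.mp rfl).symm

theorem Joined.unique {R : BrHom m n} {p q q' : ℕ ⊕ ℕ} (h : R.Joined p q) (h' : R.Joined p q')
    (hq : q ≠ p) (hq' : q' ≠ p) : q = q' := by
  obtain ⟨a, b, h1, rfl, h3⟩ := h.rel hq
  obtain ⟨a', b', rfl, rfl, h6⟩ := h'.rel hq'
  obtain rfl := Fin.val_injective.sumMap Fin.val_injective h1
  rw [(R.brauerian a).unique ⟨fun e => hq (by rw [e]), h3⟩ ⟨fun e => hq' (by rw [e]), h6⟩]

end BrHom

/-! ### Words as paths through a diagram -/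

namespace MEq

variable {V : Type u}

/-- The source point at which the reading of a letter starts. -/
def start (l : Letter) : ℕ := 2 * l.1 + if l.2 then 1 else 0

/-- The source point at which the reading of a letter finishes. -/
def finish (l : Letter) : ℕ := 2 * l.1 + if l.2 then 0 else 1

/-- The atom at position `p` has the source points `2 * p` and `2 * p + 1`. Hence the point at which
a letter is entered shows both its position and its orientation. -/
theorem start_injective : Function.Injective start := by
  rintro ⟨p, b⟩ ⟨p', b'⟩ h
  cases b <;> cases b' <;> simp [start] at h ⊢ <;> omega

theorem finish_ne_start {l l' : Letter} (h : l.1 ≠ l'.1) : finish l ≠ start l' := by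
  unfold finish start
  split <;> split <;> omega

/-- The labels `a` and `b` and the labels of the source points read in between match. -/
def Matches (ρ : ℕ → Prop) : List Letter → Prop → Prop → Prop
  | [], a, b => a = b
  | l :: w, a, b => a = ρ (start l) ∧ Matches ρ w (ρ (finish l)) b

theorem matches_append {ρ : ℕ → Prop} {u v : List Letter} {a b : Prop} :
    Matches ρ (u ++ v) a b ↔ ∃ c, Matches ρ u a c ∧ Matches ρ v c b := by
  induction u generalizing a with
  | nil => exact ⟨fun h => ⟨a, rfl, h⟩, fun ⟨c, h1, h2⟩ => (show a = c from h1) ▸ h2⟩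
  | cons l u ih =>
    simp only [List.cons_append, Matches, ih, and_assoc, exists_and_left]

theorem start_flip (l : Letter) : start (l.1, !l.2) = finish l := by
  rcases l with ⟨p, _ | _⟩ <;> rfl

theorem finish_flip (l : Letter) : finish (l.1, !l.2) = start l := by
  rcases l with ⟨p, _ | _⟩ <;> rfl

theorem Matches.flipWord {ρ : ℕ → Prop} {w : List Letter} {a b : Prop} (h : Matches ρ w a b) :
    Matches ρ (flipWord w) b a := by
  induction w generalizing a with
  | nil => exact Eq.symm h
  | cons l w ih =>
    obtain ⟨h1, h2⟩ := h
    have e : MEq.flipWord (l :: w) = MEq.flipWord w ++ [(l.1, !l.2)] := by simp [MEq.flipWord]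
    rw [e, matches_append]
    refine ⟨_, ih h2, ?_, ?_⟩
    · rw [start_flip]
    · rw [finish_flip]; exact h1.symm

theorem Matches.congr {ρ ρ' : ℕ → Prop} {w : List Letter} {a b : Prop} {N : ℕ}
    (h : Matches ρ w a b) (hw : ∀ l ∈ w, l.1 < N) (e : ∀ i < 2 * N, ρ i = ρ' i) :
    Matches ρ' w a b := by
  induction w generalizing a with
  | nil => exact h
  | cons l w ih =>
    obtain ⟨h1, h2⟩ := h
    have hl := hw l (by simp)
    have h3 : start l < 2 * N := by unfold start; split <;> omega
    have h4 : finish l < 2 * N := by unfold finish; split <;> omega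
    rw [e _ h3] at h1
    rw [e _ h4] at h2
    exact ⟨h1, ih h2 fun l' hl' => hw l' (by simp [hl'])⟩

/-- The number of occurrences of variables in an object. -/
def occ (A : MEq V) : ℕ := Formula.occ (V := V) A

/-- The diagram of an arrow. -/
def diagram {A B : MEq V} (f : A ⟶ B) : BrHom A.occ B.occ := (G V).map f

/-- The labellings `ρ` and `σ` agree on the points that are joined in the diagram of `f`. -/
def Respects {A B : MEq V} (f : A ⟶ B) (ρ σ : ℕ → Prop) : Prop := (diagram f).Respects ρ σ

section Respects

variable {A B C : MEq V} {ρ σ : ℕ → Prop}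

theorem respects_comp {f : A ⟶ B} {g : B ⟶ C} :
    Respects (f ≫ g) ρ σ ↔ ∃ τ, Respects f ρ τ ∧ Respects g τ σ := by
  have e : diagram (f ≫ g) = (diagram f).comp (diagram g) := (G V).map_comp f g
  rw [Respects, e]
  exact BrHom.respects_comp

theorem diagram_whiskerRight (f : A ⟶ B) (C : MEq V) :
    diagram (f ▷ C) = (diagram f).tensor (BrHom.lines (rfl : C.occ = C.occ)) := by
  obtain ⟨f⟩ := f
  rfl

theorem diagram_whiskerLeft (f : A ⟶ B) (C : MEq V) :
    diagram (C ◁ f) = (BrHom.lines (rfl : C.occ = C.occ)).tensor (diagram f) := by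
  obtain ⟨f⟩ := f
  rfl

theorem respects_whiskerRight {f : A ⟶ B} : Respects (f ▷ C) ρ σ ↔
    Respects f ρ σ ∧ ∀ i < C.occ, ρ (A.occ + i) = σ (B.occ + i) := by
  rw [Respects, diagram_whiskerRight]
  exact BrHom.respects_tensor.trans (and_congr Iff.rfl BrHom.respects_lines)

theorem respects_whiskerLeft {f : A ⟶ B} : Respects (C ◁ f) ρ σ ↔
    (∀ i < C.occ, ρ i = σ i) ∧ Respects f (fun i => ρ (C.occ + i)) fun i => σ (C.occ + i) := by
  rw [Respects, diagram_whiskerLeft]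
  exact BrHom.respects_tensor.trans (and_congr BrHom.respects_lines Iff.rfl)

theorem respects_id : Respects (𝟙 A) ρ σ ↔ ∀ i < A.occ, ρ i = σ i := BrHom.respects_lines

theorem respects_associator_hom :
    Respects (α_ A B C).hom ρ σ ↔ ∀ i < A.occ + B.occ + C.occ, ρ i = σ i := BrHom.respects_lines

theorem respects_rightUnitor_inv : Respects (ρ_ A).inv ρ σ ↔ ∀ i < A.occ, ρ i = σ i :=
  BrHom.respects_lines

theorem respects_unitArrow {x : V} : Respects (unitArrow x) ρ σ ↔ σ 0 = σ 1 := BrHom.respects_cap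

theorem respects_symmArrow {x y : V} :
    Respects (symmArrow x y) ρ σ ↔ ρ 0 = σ 1 ∧ ρ 1 = σ 0 := BrHom.respects_cross

theorem respects_transArrow {x y z : V} :
    Respects (transArrow x y z) ρ σ ↔ ρ 1 = ρ 2 ∧ ρ 0 = σ 0 ∧ ρ 3 = σ 1 := BrHom.respects_cup

end Respects

theorem occ_atom (x y : V) : occ (atom x y) = 2 := rfl

theorem occ_tensor (A B : MEq V) : occ (A ⊗ B) = occ A + occ B := rfl

theorem occ_obj : ∀ Γ : List (V × V), occ (obj Γ) = 2 * Γ.length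
  | [] => rfl
  | _ :: Γ => congrArg (· + 2) (occ_obj Γ)

/-- The crossing exchanges the two target points, so the path is traversed backwards. -/
theorem matches_invArrow {A : MEq V} {Γ : List (V × V)} {x y : V} {f : A ⟶ obj Γ ⊗ atom x y}
    {w : List Letter} {ρ σ : ℕ → Prop}
    (h : ∀ {σ : ℕ → Prop}, Respects f ρ σ → (∀ i < 2 * Γ.length, ρ i = σ i) ∧
      Matches ρ w (σ (2 * Γ.length)) (σ (2 * Γ.length + 1)))
    (hf : Respects (invArrow f) ρ σ) : (∀ i < 2 * Γ.length, ρ i = σ i) ∧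
      Matches ρ (flipWord w) (σ (2 * Γ.length)) (σ (2 * Γ.length + 1)) := by
  rw [invArrow, respects_comp] at hf
  obtain ⟨τ, h1, h2⟩ := hf
  rw [respects_whiskerLeft, respects_symmArrow, occ_obj,
    Nat.add_zero] at h2
  obtain ⟨h3, h4, h5⟩ := h2
  obtain ⟨h6, h7⟩ := h h1
  refine ⟨fun i hi => (h6 i hi).trans (h3 i hi), ?_⟩
  rw [← h5]
  exact h4 ▸ h7.flipWord

/-- The cup of `t` joins the end of the path along `u` to the beginning of the path along `v`. -/
theorem matches_mulArrow {Ξ Δ Γ : List (V × V)} {x y z : V} {u v : List Letter}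
    {f : obj Δ ⟶ obj Γ ⊗ atom x y} {g : obj Ξ ⟶ obj Δ ⊗ atom y z} {ρ σ : ℕ → Prop}
    (hΓ : Γ.length ≤ Δ.length) (hu : ∀ l ∈ u, l.1 < Δ.length)
    (ihf : ∀ {ρ σ : ℕ → Prop}, Respects f ρ σ → (∀ i < 2 * Γ.length, ρ i = σ i) ∧
      Matches ρ u (σ (2 * Γ.length)) (σ (2 * Γ.length + 1)))
    (ihg : ∀ {ρ σ : ℕ → Prop}, Respects g ρ σ → (∀ i < 2 * Δ.length, ρ i = σ i) ∧
      Matches ρ v (σ (2 * Δ.length)) (σ (2 * Δ.length + 1)))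
    (h : Respects (mulArrow f g) ρ σ) : (∀ i < 2 * Γ.length, ρ i = σ i) ∧
      Matches ρ (u ++ v) (σ (2 * Γ.length)) (σ (2 * Γ.length + 1)) := by
  simp only [mulArrow, respects_comp, respects_whiskerLeft, respects_whiskerRight,
    respects_associator_hom, respects_transArrow, occ_obj, occ_tensor, occ_atom,
    Nat.add_zero] at h
  obtain ⟨τ, h1, τ', ⟨h2, h3⟩, τ'', h4, h5, h6, h7, h8⟩ := h
  obtain ⟨h9, h10⟩ := ihg h1
  obtain ⟨h11, h12⟩ := ihf h2
  refine ⟨fun i hi => ?_, ?_⟩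
  · rw [h9 i (by omega), h11 i hi, h4 i (by omega), h5 i hi]
  · rw [matches_append]
    -- The junction is the left variable of the factor produced by `g`, which the cup joins to the
    -- right variable of the factor produced by `f`. The path along `u` uses only points of `obj Δ`,
    -- where `g` consists of vertical lines, so its labels may be taken in the source of `g`.
    refine ⟨τ (2 * Δ.length), ?_, ?_⟩
    · have h13 := h12.congr hu fun i hi => (h9 i hi).symm
      rw [h4 _ (by omega), h4 _ (by omega), h6] at h13
      have h14 : τ (2 * Δ.length) = τ'' (2 * Γ.length + 2) :=
        (h3 0 (by omega)).trans (h4 _ (by omega))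
      rw [← h7, h14]
      exact h13
    · have := h3 1 (by omega)
      rw [h4 _ (by omega)] at this
      rw [← h8]
      rwa [this] at h10

theorem IsTree.matches {Ξ Γ : List (V × V)} {x y : V} {w : List Letter}
    {f : obj Ξ ⟶ obj Γ ⊗ atom x y} (h : IsTree w f) : ∀ {ρ σ : ℕ → Prop},
    Respects f ρ σ → (∀ i < 2 * Γ.length, ρ i = σ i) ∧
      Matches ρ w (σ (2 * Γ.length)) (σ (2 * Γ.length + 1)) := by
  have id_matches : ∀ {Γ : List (V × V)} {x y : V} {ρ σ : ℕ → Prop},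
      Respects (𝟙 (obj Γ ⊗ atom x y)) ρ σ → (∀ i < 2 * Γ.length, ρ i = σ i) ∧
        Matches ρ [(Γ.length, false)] (σ (2 * Γ.length)) (σ (2 * Γ.length + 1)) := by
    intro Γ x y ρ σ h
    rw [respects_id, occ_tensor, occ_obj, occ_atom] at h
    exact ⟨fun i hi => h i (by omega), (h _ (by omega)).symm, h (2 * Γ.length + 1) (by omega)⟩
  induction h with
  | pos Γ x y => exact id_matches
  | neg Γ x y => exact matches_invArrow id_matches
  | mul h1 h2 ih1 ih2 =>
    exact matches_mulArrow h1.suffix.length_le (fun l hl => (h1.position_mem l hl).2) ih1 ih2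
  | invMul h1 h2 ih1 ih2 =>
    exact matches_invArrow
      (matches_mulArrow h1.suffix.length_le (fun l hl => (h1.position_mem l hl).2) ih1 ih2)

/-- The labels match along the words of a forest. -/
def ForestMatches (ρ σ : ℕ → Prop) : List (List Letter) → Prop
  | [] => True
  -- The head belongs to the last conjunct, which has `W.length` conjuncts with two points each to
  -- its left.
  | w :: W => Matches ρ w (σ (2 * W.length)) (σ (2 * W.length + 1)) ∧ ForestMatches ρ σ W

theorem ForestMatches.congr {ρ ρ' σ σ' : ℕ → Prop} {W : List (List Letter)} {N : ℕ}
    (h : ForestMatches ρ σ W) (hW : ∀ w ∈ W, ∀ l ∈ w, l.1 < N) (e : ∀ i < 2 * N, ρ i = ρ' i)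
    (e' : ∀ i < 2 * W.length, σ i = σ' i) : ForestMatches ρ' σ' W := by
  induction W with
  | nil => trivial
  | cons w W ih =>
    obtain ⟨h1, h2⟩ := h
    rw [List.length_cons] at e'
    refine ⟨?_, ih h2 (fun w' hw' => hW w' (by simp [hw'])) fun i hi => e' i (by omega)⟩
    rw [← e' _ (by omega), ← e' _ (by omega)]
    exact h1.congr (hW w (by simp)) e

namespace IsForest

variable {Ξ Δ : List (V × V)} {W : List (List Letter)} {f : obj Ξ ⟶ obj Δ}

theorem length_eq (h : IsForest W f) : W.length = Δ.length := by
  induction h with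
  | nil => rfl
  | cons _ _ ih => simp [ih]
  | unit _ _ ih => simp [ih]

theorem position_lt (h : IsForest W f) : ∀ w ∈ W, ∀ l ∈ w, l.1 < Ξ.length := by
  induction h with
  | nil => simp
  | cons h1 _ ih =>
    rintro w (_ | ⟨_, hw⟩) l hl
    · exact (h1.position_mem l hl).2
    · exact (ih w hw l hl).trans_le h1.suffix.length_le
  | unit _ _ ih =>
    rintro w (_ | ⟨_, hw⟩) l hl
    · cases hl
    · exact ih w hw l hl

theorem nodup (h : IsForest W f) : ∀ w ∈ W, (w.map Prod.fst).Nodup := by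
  induction h with
  | nil => simp
  | cons h1 _ ih =>
    rintro w (_ | ⟨_, hw⟩)
    · exact h1.nodup
    · exact ih w hw
  | unit _ _ ih =>
    rintro w (_ | ⟨_, hw⟩)
    · exact List.nodup_nil
    · exact ih w hw

/-- This one implication suffices. Two arrows with equal diagrams are respected by the same
labellings, so the words of both forests are paths in one diagram. -/
theorem forestMatches (h : IsForest W f) : ∀ {ρ σ : ℕ → Prop}, Respects f ρ σ →
    ForestMatches ρ σ W := by
  induction h with
  | nil => exact fun _ => trivial
  | @cons Ξ Γ Δ x y w W f h h1 h2 ih =>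
    intro ρ σ hσ
    have hσ' : Respects (f ≫ h ▷ atom x y) ρ σ := hσ
    rw [respects_comp] at hσ'
    obtain ⟨τ, h3, h4⟩ := hσ'
    rw [respects_whiskerRight, occ_obj, occ_obj, ← h2.length_eq] at h4
    obtain ⟨h5, h6⟩ := h4
    obtain ⟨h7, h8⟩ := h1.matches h3
    refine ⟨?_, (ih h5).congr h2.position_lt (fun i hi => (h7 i hi).symm) fun _ _ => rfl⟩
    have e0 := h6 0 two_pos
    have e1 := h6 1 one_lt_two
    rw [← e1]
    exact e0 ▸ h8
  | @unit Ξ Δ x W h h1 ih =>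
    intro ρ σ hσ
    have hσ' : Respects (h ≫ (ρ_ (obj Δ)).inv ≫ obj Δ ◁ unitArrow x) ρ σ := hσ
    simp only [respects_comp, respects_rightUnitor_inv, respects_whiskerLeft,
      occ_obj, respects_unitArrow] at hσ'
    obtain ⟨τ, h2, τ', h3, h4, h5⟩ := hσ'
    rw [← h1.length_eq] at h3 h4 h5
    exact ⟨h5, (ih h2).congr h1.position_lt (fun _ _ => rfl) fun i hi =>
      (h3 i hi).trans (h4 i hi)⟩

end IsForest

/-! ### Recovering the words from the diagram -/

/-- `r` relates `a` and `b` and the source points read in between in the order of reading. -/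
def Linked (r : ℕ ⊕ ℕ → ℕ ⊕ ℕ → Prop) : List Letter → ℕ ⊕ ℕ → ℕ ⊕ ℕ → Prop
  | [], a, b => r a b
  | l :: w, a, b => r a (.inl (start l)) ∧ Linked r w (.inl (finish l)) b

theorem linked_joined {m n : ℕ} {R : BrHom m n} {w : List Letter} {a b : ℕ ⊕ ℕ}
    (h : ∀ ρ σ, R.Respects ρ σ → Matches ρ w (Sum.elim ρ σ a) (Sum.elim ρ σ b)) :
    Linked R.Joined w a b := by
  induction w generalizing a with
  | nil => exact h
  | cons l w ih => exact ⟨fun ρ σ hσ => (h ρ σ hσ).1, ih fun ρ σ hσ => (h ρ σ hσ).2⟩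

/-- Each point is joined to at most one other point, so the next point of the path is forced: either
the final target point, which ends both words, or a source point, which fixes the next letter. The
inequalities exclude the trivial case of a point joined to itself. -/
theorem Linked.unique {m n : ℕ} {R : BrHom m n} {w w' : List Letter} {a : ℕ ⊕ ℕ} {j : ℕ}
    (h : Linked R.Joined w a (.inr j)) (h' : Linked R.Joined w' a (.inr j))
    (hw : (w.map Prod.fst).Nodup) (hw' : (w'.map Prod.fst).Nodup)
    (ha : ∀ l ∈ w, .inl (start l) ≠ a) (ha' : ∀ l ∈ w', .inl (start l) ≠ a) (hj : .inr j ≠ a) :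
    w = w' := by
  induction w generalizing a w' with
  | nil =>
    cases w' with
    | nil => rfl
    | cons l' w' => cases BrHom.Joined.unique h h'.1 hj (ha' l' (by simp))
  | cons l w ih =>
    cases w' with
    | nil => cases BrHom.Joined.unique h.1 h' (ha l (by simp)) hj
    | cons l' w' =>
      obtain rfl := start_injective (Sum.inl_injective
        (h.1.unique h'.1 (ha l (by simp)) (ha' l' (by simp))))
      rw [List.map_cons, List.nodup_cons] at hw hw'
      -- The path resumes at `finish l`. No later letter starts there, because positions do not
      -- repeat.
      have aux : ∀ {w : List Letter}, l.1 ∉ w.map Prod.fst →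
          ∀ l' ∈ w, (.inl (start l') : ℕ ⊕ ℕ) ≠ .inl (finish l) := fun hl l' hl' e =>
        finish_ne_start (l := l) (l' := l') (fun e' => hl (e' ▸ List.mem_map_of_mem hl'))
          (Sum.inl_injective e).symm
      rw [ih h.2 h'.2 hw.2 hw'.2 (aux hw.1) (aux hw'.1) Sum.inr_ne_inl]

theorem eq_of_forestMatches {m n : ℕ} {R : BrHom m n} {W W' : List (List Letter)}
    (h : ∀ ρ σ, R.Respects ρ σ → ForestMatches ρ σ W)
    (h' : ∀ ρ σ, R.Respects ρ σ → ForestMatches ρ σ W')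
    (hW : ∀ w ∈ W, (w.map Prod.fst).Nodup) (hW' : ∀ w ∈ W', (w.map Prod.fst).Nodup)
    (e : W.length = W'.length) : W = W' := by
  induction W generalizing W' with
  | nil => exact (List.length_eq_zero_iff.1 e.symm).symm
  | cons w W ih =>
    cases W' with
    | nil => cases e
    | cons w' W' =>
      rw [List.length_cons, List.length_cons, Nat.add_right_cancel_iff] at e
      congr 1
      · have h1 : Linked R.Joined w (.inr (2 * W.length)) (.inr (2 * W.length + 1)) :=
          linked_joined fun ρ σ hσ => (h ρ σ hσ).1
        have h2 : Linked R.Joined w' (.inr (2 * W.length)) (.inr (2 * W.length + 1)) :=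
          linked_joined fun ρ σ hσ => e ▸ (h' ρ σ hσ).1
        exact h1.unique h2 (hW w (by simp)) (hW' w' (by simp)) (fun _ _ => Sum.inl_ne_inr)
          (fun _ _ => Sum.inl_ne_inr) (by simp)
      · exact ih (fun ρ σ hσ => (h ρ σ hσ).2) (fun ρ σ hσ => (h' ρ σ hσ).2)
          (fun v hv => hW v (by simp [hv])) (fun v hv => hW' v (by simp [hv])) e

/-- Flattening composes a whiskering of the arrow with isomorphisms that do not depend on the arrow,
and `G` respects both operations. -/
theorem diagram_flatArrow_congr {A B : Formula V} {f g : ofFormula A ⟶ ofFormula B}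
    (h : diagram f = diagram g)
    (Γ : List (V × V)) : diagram (flatArrow f Γ) = diagram (flatArrow g Γ) := by
  have e : (G V).map (obj Γ ◁ f) = (G V).map (obj Γ ◁ g) :=
    (diagram_whiskerLeft f _).trans ((congrArg _ h).trans (diagram_whiskerLeft g _).symm)
  simp only [diagram, flatArrow, Functor.map_comp, e]
  rfl

theorem eq_of_diagram_eq {A B : Formula V} {f g : ofFormula A ⟶ ofFormula B}
    (h : diagram f = diagram g) : f = g := by
  obtain ⟨W, hW⟩ := exists_isForest_flatArrow f
  obtain ⟨W', hW'⟩ := exists_isForest_flatArrow g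
  obtain rfl := eq_of_forestMatches (R := diagram (flatArrow f [])) (W' := W')
    (fun _ _ => hW.forestMatches)
    (fun ρ σ hσ => hW'.forestMatches
      ((congrArg (fun R => BrHom.Respects R ρ σ) (diagram_flatArrow_congr h [])).mp hσ))
    hW.nodup hW'.nodup (hW.length_eq.trans hW'.length_eq.symm)
  exact flatArrow_injective (hW.unique hW')

end MEq

theorem mainTheorem3 (V : Type*) : (MEq.G V).Faithful := by
  exact ⟨fun {A B} _ _ h => MEq.eq_of_diagram_eq (A := A) (B := B) h⟩
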